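/- Let $p$ be an odd prime and let $m,\ell$ be positive integers such that $m_\ell := m/(m,\ell)$ is even and $m>6\ell$, where $(m,\ell)$ denotes the greatest common divisor. Put $\delta=(m,\ell)$ and $\varepsilon_\ell=(-1)^{m_\ell/2}$. Let $\mathcal{L}_{\ell,3\ell}=\langle x^{p^\ell},x^{p^{3\ell}}\rangle$ be the $\mathbb{F}_{p^m}$-subspace of $\mathbb{F}_{p^m}[x]$ spanned by $x^{p^\ell}$ and $x^{p^{3\ell}}$, and consider the linear code over $\mathbb{F}_p$ of length $p^m-1$ $$\mathcal{C}_{\mathcal{L}_{\ell,3\ell}}=\Big\{\big(\mathrm{Tr}_{\mathbb{F}_{p^m}/\mathbb{F}_p}(xR(x))\big)_{x\in\mathbb{F}_{p^m}^*} : R\in\mathcal{L}_{\ell,3\ell}\Big\}.$$ For a linear code $\mathcal{C}\subseteq\mathbb{F}_p^n$, with the elements of $\mathbb{F}_p$ listed as $\omega_0=0,\omega_1,\ldots,\omega_{p-1}$, the complete weight enumerator is $$W_{\mathcal{C}}(z_0,\ldots,z_{p-1})=\sum_{t_0+\cdots+t_{p-1}=n}A(t_0,\ldots,t_{p-1})\,z_0^{t_0}\cdots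 z_{p-1}^{t_{p-1}},$$ where the sum is over nonnegative integers $t_i$ and $A(t_0,\ldots,t_{p-1})$ is the number of codewords in $\mathcal{C}$ having, for every $i$, exactly $t_i$ coordinates equal to $\omega_i$. Then $$W_{\mathcal{C}_{\mathcal{L}_{\ell,3\ell}}}(z_0,\ldots,z_{p-1})=z_0^{p^m-1}+\sum_{i=0}^{3}F_i\,z_0^{a_i}z_1^{b_i}\cdots z_{p-1}^{b_i},$$ where, for $i=0,\ldots,3$, the numbers $$a_i=p^{m-1}+(-1)^i\varepsilon_\ell(p-1)p^{\frac m2+i\delta-1}-1,\qquad b_i=p^{m-1}+(-1)^{i+1}\varepsilon_\ell\,p^{\frac m2+i\delta-1}$$ are nonnegative integers and, with $D=p^{6\delta}+p^{5\delta}-p^{4\delta}+p^{2\delta}-p^{\delta}-1$ and $\Sigma=\sum_{i=0}^{5}(-1)^{i+1}p^{i\delta}$, $$\begin{aligned} D F_0&=p^{2m+6\delta}-p^{2m+4\delta}-p^{2m+\delta}+p^{m+4\delta}+p^{m+\delta}-p^{6\delta}+\varepsilon_\ell\big(p^{\frac{3m}2+5\delta}-p^{\frac{3m}2+4\delta}-p^{\frac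 m2+5\delta}+p^{\frac m2+4\delta}\big),\\ D F_1&=p^{2m-2\delta}(p^{7\delta}-p^{2\delta}-1)+p^{m-2\delta}(p^{5\delta}-p^{6\delta}+p^{2\delta}+1)-p^{3\delta}(p^{2\delta}-p^{\delta}+1)-\varepsilon_\ell\big(p^{\frac{3m}2}-p^{\frac m2}\big)\Sigma,\\ D F_2&=p^{2m-3\delta}(p^{5\delta}+p^{\delta}-1)-p^{m-3\delta}(p^{6\delta}+p^{4\delta}+p^{\delta}-1)+p^{\delta}(p^{2\delta}-p^{\delta}+1)+\varepsilon_\ell\big(p^{\frac{3m}2-2\delta}-p^{\frac m2-2\delta}\big)\Sigma,\\ D F_3&=p^{2m-3\delta}-p^{m}-p^{m-3\delta}+1-\varepsilon_\ell\big(p^{\frac{3m}2-\delta}-p^{\frac{3m}2-2\delta}-p^{\frac m2-\delta}+p^{\frac m2-2\delta}\big). \end{aligned}$$ -/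

import Mathlib

open Polynomial

noncomputable section

namespace TraceCode

/-- The word `(Tr_{K/F}(x R(x)))` indexed by the nonzero elements `x` of `K`, as an `F`-linear
function of the polynomial `R ∈ K[X]`. -/
def word (F K : Type*) [Field F] [Field K] [Algebra F K] : K[X] →ₗ[F] (Kˣ → F) where
  toFun R := fun x => Algebra.trace F K ((x : K) * R.eval (x : K))
  map_add' R S := by
    funext x
    simp [mul_add]
  map_smul' c R := by
    funext x
    simp

/-- The code `C_L = { (Tr_{K/F}(x R(x)))_{x ∈ K^*} : R ∈ L }`, a linear code over `F`
whose coordinates are indexed by `K^*`. -/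
def code (F : Type*) {K : Type*} [Field F] [Field K] [Algebra F K]
    (L : Submodule K K[X]) : Submodule F (Kˣ → F) :=
  (L.restrictScalars F).map (word F K)

/-- The family `⟨x^{p^ℓ}, x^{p^{3ℓ}}⟩`, a `K`-subspace of `K[X]`. -/
def familyL (K : Type*) [Field K] (p ℓ : ℕ) : Submodule K K[X] :=
  Submodule.span K {(X : K[X]) ^ p ^ ℓ, (X : K[X]) ^ p ^ (3 * ℓ)}

/-- The composition of a word `v` over `F`: for each `a ∈ F`, the number of coordinates of `v`
equal to `a`. -/
def comp {ι F : Type*} [Fintype ι] [Fintype F] [DecidableEq F] (v : ι → F) : F →₀ ℕ :=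
  Finsupp.equivFunOnFinite.symm fun a => (Finset.univ.filter fun j => v j = a).card

/-- The complete weight enumerator of a linear code `C ⊆ F^ι`. The variables are indexed by
the elements of `F`; the sum runs over all `t : F → ℕ` with `∑ a, t a = n`, where `n` is the
length, and the coefficient of `∏ a, z_a ^ t a` is the number of codewords of
composition `t`. -/
def completeWeightEnumerator {ι F : Type*} [Fintype ι] [Field F] [Fintype F] [DecidableEq F]
    (C : Submodule F (ι → F)) : MvPolynomial F ℚ :=
  ∑ t ∈ Finset.finsuppAntidiag (Finset.univ : Finset F) (Fintype.card ι),
    MvPolynomial.monomial t (({c : ι → F | c ∈ C ∧ comp c = t}.ncard : ℕ) : ℚ)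

/-- `m_ℓ = m / (m, ℓ)`. -/
def mSub (m ℓ : ℕ) : ℕ := m / m.gcd ℓ

/-- `ε_ℓ = (-1)^{m_ℓ / 2}` (used for even `m_ℓ`). -/
def eps (m ℓ : ℕ) : ℤ := (-1) ^ (mSub m ℓ / 2)

/-- The common denominator `p^{6δ} + p^{5δ} - p^{4δ} + p^{2δ} - p^δ - 1` of the frequencies. -/
def freqDen (p δ : ℕ) : ℚ :=
  (p : ℚ) ^ (6 * δ) + (p : ℚ) ^ (5 * δ) - (p : ℚ) ^ (4 * δ) + (p : ℚ) ^ (2 * δ) - (p : ℚ) ^ δ - 1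

/-- The alternating sum `∑_{i=0}^{5} (-1)^{i+1} p^{iδ}`. -/
def altSum (p δ : ℕ) : ℚ :=
  ∑ i ∈ Finset.range 6, (-1) ^ (i + 1) * (p : ℚ) ^ (i * δ)

/-- The numerators of the frequencies, in terms of `p`, `m`, `δ` and the sign `ε`. -/
def freqNum (p m δ : ℕ) (ε : ℚ) : Fin 4 → ℚ :=
  let P : ℚ := p
  ![P ^ (2 * m + 6 * δ) - P ^ (2 * m + 4 * δ) - P ^ (2 * m + δ) + P ^ (m + 4 * δ) + P ^ (m + δ)
      - P ^ (6 * δ)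
      + ε * (P ^ (3 * (m / 2) + 5 * δ) - P ^ (3 * (m / 2) + 4 * δ)
        - P ^ (m / 2 + 5 * δ) + P ^ (m / 2 + 4 * δ)),
    P ^ (2 * m - 2 * δ) * (P ^ (7 * δ) - P ^ (2 * δ) - 1)
      + P ^ (m - 2 * δ) * (P ^ (5 * δ) - P ^ (6 * δ) + P ^ (2 * δ) + 1)
      - P ^ (3 * δ) * (P ^ (2 * δ) - P ^ δ + 1)
      - ε * (P ^ (3 * (m / 2)) - P ^ (m / 2)) * altSum p δ,
    P ^ (2 * m - 3 * δ) * (P ^ (5 * δ) + P ^ δ - 1)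
      - P ^ (m - 3 * δ) * (P ^ (6 * δ) + P ^ (4 * δ) + P ^ δ - 1)
      + P ^ δ * (P ^ (2 * δ) - P ^ δ + 1)
      + ε * (P ^ (3 * (m / 2) - 2 * δ) - P ^ (m / 2 - 2 * δ)) * altSum p δ,
    P ^ (2 * m - 3 * δ) - P ^ m - P ^ (m - 3 * δ) + 1
      - ε * (P ^ (3 * (m / 2) - δ) - P ^ (3 * (m / 2) - 2 * δ)
        - P ^ (m / 2 - δ) + P ^ (m / 2 - 2 * δ))]

/-- The frequencies `F_0, F_1, F_2, F_3`, with `δ = (m, ℓ)`. -/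
def freq (p m ℓ : ℕ) (i : Fin 4) : ℚ :=
  freqNum p m (m.gcd ℓ) (eps m ℓ) i / freqDen p (m.gcd ℓ)

/-- `a_i = p^{m-1} + (-1)^i ε_ℓ (p-1) p^{m/2 + i(m,ℓ) - 1} - 1`. -/
def expA (p m ℓ : ℕ) (i : Fin 4) : ℤ :=
  (p : ℤ) ^ (m - 1)
    + (-1) ^ (i : ℕ) * eps m ℓ * ((p : ℤ) - 1) * (p : ℤ) ^ (m / 2 + (i : ℕ) * m.gcd ℓ - 1) - 1

/-- `b_i = p^{m-1} + (-1)^{i+1} ε_ℓ p^{m/2 + i(m,ℓ) - 1}`. -/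
def expB (p m ℓ : ℕ) (i : Fin 4) : ℤ :=
  (p : ℤ) ^ (m - 1)
    + (-1) ^ ((i : ℕ) + 1) * eps m ℓ * (p : ℤ) ^ (m / 2 + (i : ℕ) * m.gcd ℓ - 1)

end TraceCode

end

/-! Let σ be `x ↦ x ^ p ^ ℓ`, Q = p^δ and m = 2Nδ; then k = ℓ/δ is odd and prime to N, and N ≥ 4.
The codewords are the values on `Kˣ` of the forms f_a(x) = Tr(a₁ x σ(x) + a₂ x σ³(x)).

The equation u σ(u) = c has Q + 1 solutions for every nonzero c fixed by σ (`NormRegular`). Each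
such u is fixed by σ², so for c in `F` the substitution x ↦ ux multiplies f_a by c. All nonzero
values are therefore equally frequent, and the composition of a word depends only on S(a) = `excess
σ a`, which is also the sum of ψ(f_a) for every nontrivial ψ.

Squaring gives S(a)² = |K| · |ker|, where ker is the kernel of the polar operator. It is a space
over the field of Q² elements fixed by σ² and, for a ≠ 0, has dimension at most 3; hence S(a) =
±Q^(N+i) with i ≤ 3. The norm-one group acts freely away from 0, so S(a) ≡ 1 mod Q + 1, which fixes
the sign: S(a) = (-Q)^(N+i) (`NormRegular.exists_excess_eq`).

The four multiplicities follow from the moments of S of order 0 to 3. By orthogonality these count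
solutions of ∑ xⱼ σ(xⱼ) = ∑ xⱼ σ³(xⱼ) = 0 in one, two or three variables; the last count reduces to
affine points of a Hermitian curve (`NormRegular.card_hermitian`). A Vandermonde system then gives
the frequencies (`eq_freqNum_of_moments`). -/

namespace TraceCode

open Finset

/-! ### Power maps and norm equations in finite fields. -/

theorem gcd_pow_sub_one_pow_add_one {Q N k : ℕ} (hQ : 0 < Q) (hk : Odd k) (hNk : Nat.Coprime k N) :
    (Q ^ (2 * N) - 1).gcd (Q ^ k + 1) = Q + 1 := by
  have hsq : (Q + 1) ∣ Q ^ 2 - 1 := ⟨Q - 1, by rw [← Nat.sq_sub_sq Q 1]⟩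
  have hg : (Q ^ (2 * N) - 1).gcd (Q ^ (2 * k) - 1) = Q ^ 2 - 1 := by
    rw [Nat.pow_sub_one_gcd_pow_sub_one, Nat.gcd_mul_left, Nat.gcd_comm N k, hNk]
  have hk2 : (Q ^ k + 1) ∣ Q ^ (2 * k) - 1 :=
    ⟨Q ^ k - 1, by rw [← Nat.sq_sub_sq (Q ^ k) 1, ← pow_mul, mul_comm 2 k]⟩
  apply Nat.dvd_antisymm
  · have h1 : (Q ^ (2 * N) - 1).gcd (Q ^ k + 1) ∣ Q ^ 2 - 1 := by
      rw [← hg]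
      exact Nat.gcd_dvd_gcd_of_dvd_right _ hk2
    obtain ⟨j, rfl⟩ := hk
    have h2 : Q ^ 2 - 1 ∣ Q ^ (2 * j) - 1 := by
      rw [pow_mul]
      simpa using Nat.sub_dvd_pow_sub_pow (Q ^ 2) 1 j
    -- Modulo Q² - 1 an odd power of Q is Q, so Q^k + 1 ≡ Q + 1.
    have h3 : Q ^ (2 * j + 1) + 1 = Q * (Q ^ (2 * j) - 1) + (Q + 1) := by
      have : 1 ≤ Q ^ (2 * j) := Nat.one_le_pow _ _ hQ
      rw [Nat.mul_sub, pow_succ]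
      have : Q ≤ Q * Q ^ (2 * j) := Nat.le_mul_of_pos_right _ this
      rw [mul_comm (Q ^ (2 * j)) Q]
      omega
    have h4 := Nat.gcd_dvd_right (Q ^ (2 * N) - 1) (Q ^ (2 * j + 1) + 1)
    exact (Nat.dvd_add_right ((h1.trans h2).mul_left Q)).1 (h3 ▸ h4)
  · refine Nat.dvd_gcd (hsq.trans ?_) ?_
    · rw [pow_mul]
      simpa using Nat.sub_dvd_pow_sub_pow (Q ^ 2) 1 N
    · simpa using hk.nat_add_dvd_pow_add_pow Q 1

/-- In a finite cyclic group, the `d`-th power map takes each value `c` with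
`c ^ (|G| / gcd (|G|, d)) = 1` exactly `gcd (|G|, d)` times. -/
theorem card_pow_eq_of_isCyclic {G : Type*} [CommGroup G] [IsCyclic G] [Fintype G] [DecidableEq G]
    (d : ℕ) {c : G} (hc : c ^ (Fintype.card G / (Fintype.card G).gcd d) = 1) :
    #{x : G | x ^ d = c} = (Fintype.card G).gcd d := by
  obtain ⟨g, hg⟩ := IsCyclic.exists_generator (α := G)
  have hord : orderOf g = Fintype.card G := by
    rw [orderOf_eq_card_of_forall_mem_zpowers hg, Nat.card_eq_fintype_card]
  have hpos : 0 < Fintype.card G := Fintype.card_pos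
  set s := (Fintype.card G).gcd d with hs
  have hspos : 0 < s := Nat.gcd_pos_of_pos_left _ hpos
  have hmem : c ∈ (powMonoidHom d : G →* G).range := by
    obtain ⟨k, rfl⟩ := Subgroup.mem_zpowers_iff.1 (hg c)
    have h1 : ((Fintype.card G : ℕ) : ℤ) ∣ k * (Fintype.card G / s : ℕ) := by
      rw [← hord, orderOf_dvd_iff_zpow_eq_one, zpow_mul, zpow_natCast, hord]
      exact hc
    have h2 : (s : ℤ) ∣ k := by
      obtain ⟨t, ht⟩ := Nat.gcd_dvd_left (Fintype.card G) d
      rw [← hs] at ht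
      rw [ht, Nat.mul_div_cancel_left _ hspos] at h1
      have htpos : (t : ℤ) ≠ 0 := by
        rintro h
        simp at h
        simp [h] at ht
      push_cast at h1
      exact Int.dvd_of_mul_dvd_mul_right htpos h1
    obtain ⟨j, rfl⟩ := h2
    refine ⟨g ^ (Nat.gcdB (Fintype.card G) d * j), ?_⟩
    have hb := Nat.gcd_eq_gcd_ab (Fintype.card G) d
    rw [powMonoidHom_apply, ← zpow_natCast, ← zpow_mul, hs, hb]
    have : ((Fintype.card G : ℤ) * Nat.gcdA (Fintype.card G) d
          + d * Nat.gcdB (Fintype.card G) d) * j = (Fintype.card G : ℤ) * (Nat.gcdA (Fintype.card G) d * j)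
          + Nat.gcdB (Fintype.card G) d * j * d := by ring
    rw [this, zpow_add, zpow_mul g (Fintype.card G : ℤ), zpow_natCast, pow_card_eq_one, one_zpow,
      one_mul]
  have h := MonoidHom.card_fiber_eq_of_mem_range (powMonoidHom d : G →* G) hmem
    (one_mem (powMonoidHom d : G →* G).range)
  simp only [powMonoidHom_apply] at h
  have hk := IsCyclic.card_powMonoidHom_ker (G := G) d
  rw [Nat.card_eq_fintype_card (α := G)] at hk
  rw [h, hs, ← hk, Nat.card_eq_fintype_card, Fintype.card_subtype]
  congr 1
  ext x
  simp [MonoidHom.mem_ker]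

theorem card_filter_units {K : Type*} [Field K] [Fintype K] [DecidableEq K] (P : K → Prop)
    [DecidablePred P] (h0 : ¬ P 0) : #{x : K | P x} = #{x : Kˣ | P x} := by
  rw [← card_map ⟨((↑) : Kˣ → K), Units.val_injective⟩]
  congr 1
  ext x
  simp only [mem_filter, mem_univ, true_and, mem_map, Function.Embedding.coeFn_mk]
  constructor
  · intro hx
    exact ⟨Units.mk0 x (by rintro rfl; exact h0 hx), hx, rfl⟩
  · rintro ⟨u, hu, rfl⟩
    exact hu

section

variable {p m ℓ : ℕ} [Fact p.Prime] {K : Type*} [Field K] [Fintype K] [DecidableEq K]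

/-- The number of elements of `𝔽_{p^m}` fixed by the `k`-th power of the Frobenius. -/
theorem card_pow_eq_self (hK : Fintype.card K = p ^ m) (k : ℕ) :
    #{x : K | x ^ p ^ k = x} = p ^ m.gcd k := by
  have hp : 0 < p := (Fact.out : p.Prime).pos
  have hpk : 0 < p ^ k := pow_pos hp k
  have h1 : ({x : K | x ^ p ^ k = x} : Finset K) =
      insert 0 ({x : K | x ^ (p ^ k - 1) = 1 ∧ x ≠ 0} : Finset K) := by
    ext x
    simp only [mem_filter, mem_univ, true_and, mem_insert]
    by_cases hx : x = 0
    · simp [hx, hp.ne']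
    · simp only [hx, false_or, ne_eq, not_false_eq_true, and_true]
      conv_lhs => rw [← Nat.sub_add_cancel hpk, pow_succ]
      simp [hx]
  have h2 : #{x : K | x ^ (p ^ k - 1) = 1 ∧ x ≠ 0} = p ^ m.gcd k - 1 := by
    rw [card_filter_units (fun x : K => x ^ (p ^ k - 1) = 1 ∧ x ≠ 0) (by simp)]
    have h3 := card_pow_eq_of_isCyclic (G := Kˣ) (p ^ k - 1) (c := 1) (one_pow _)
    rw [Fintype.card_units, hK, Nat.pow_sub_one_gcd_pow_sub_one] at h3
    rw [← h3]
    congr 1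
    ext x
    simp [Units.ext_iff]
  rw [h1, card_insert_of_notMem (by simp), h2, Nat.sub_add_cancel (Nat.one_le_pow _ _ hp)]

/-- The number of solutions of the norm equation `u ^ (p^ℓ + 1) = c` over `𝔽_{p^m}`. -/
theorem card_norm_eq (hK : Fintype.card K = p ^ m) {δ N k : ℕ} (hm : m = δ * (2 * N))
    (hℓ : ℓ = δ * k) (hk : Odd k) (hkN : k.Coprime N) {c : K} (hc0 : c ≠ 0)
    (hc : c ^ p ^ ℓ = c) : #{u : K | u * u ^ p ^ ℓ = c} = p ^ δ + 1 := by
  have hp : 0 < p := (Fact.out : p.Prime).pos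
  have hQ : 0 < p ^ δ := pow_pos hp δ
  rw [card_filter_units (fun x : K => x * x ^ p ^ ℓ = c) (by simpa using hc0.symm)]
  have hg : (Fintype.card Kˣ).gcd (p ^ ℓ + 1) = p ^ δ + 1 := by
    rw [Fintype.card_units, hK, hm, hℓ, pow_mul, pow_mul p δ k]
    exact gcd_pow_sub_one_pow_add_one hQ hk hkN
  have hcu : Units.mk0 c hc0 ^ (Fintype.card Kˣ / (Fintype.card Kˣ).gcd (p ^ ℓ + 1)) = 1 := by
    rw [hg]
    -- Being fixed by σ, c lies in the subfield of p^δ elements, because gcd(m, ℓ) = δ. Its order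
    -- then divides p^δ - 1, and (p^δ - 1)(p^δ + 1) divides p^m - 1.
    have h1 : Units.mk0 c hc0 ^ (p ^ δ - 1) = 1 := by
      have hd : p ^ δ - 1 = (p ^ m - 1).gcd (p ^ ℓ - 1) := by
        rw [Nat.pow_sub_one_gcd_pow_sub_one, hm, hℓ, Nat.gcd_mul_left]
        have : Nat.gcd (2 * N) k = 1 :=
          (Nat.Coprime.mul_left (Nat.coprime_two_left.2 hk) hkN.symm)
        rw [this, mul_one]
      rw [hd, ← orderOf_dvd_iff_pow_eq_one]
      refine Nat.dvd_gcd ?_ ?_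
      · rw [← hK, ← Fintype.card_units]
        exact orderOf_dvd_card
      · rw [orderOf_dvd_iff_pow_eq_one]
        ext
        have hpl : 0 < p ^ ℓ := pow_pos hp ℓ
        rw [← Nat.sub_add_cancel hpl, pow_succ] at hc
        simpa [hc0] using hc
    have h2 : (p ^ δ - 1) ∣ Fintype.card Kˣ / (p ^ δ + 1) := by
      apply Nat.dvd_div_of_mul_dvd
      rw [← Nat.sq_sub_sq (p ^ δ) 1, Fintype.card_units, hK, hm, pow_mul, pow_mul (p ^ δ) 2 N]
      simpa using Nat.sub_dvd_pow_sub_pow ((p ^ δ) ^ 2) 1 N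
    obtain ⟨t, ht⟩ := h2
    rw [ht, pow_mul, h1, one_pow]
  rw [← hg, ← card_pow_eq_of_isCyclic (p ^ ℓ + 1) hcu]
  congr 1
  ext x
  simp [Units.ext_iff, pow_succ']

end

/-! ### Abel summation and the number of zeros of a τ-polynomial. -/

theorem sum_mul_eq_neg_sum_partialSums {R : Type*} [CommRing R] (d y : ℕ → R) (n : ℕ) :
    ∑ i ∈ range (n + 1), d i * y i = (∑ i ∈ range (n + 1), d i) * y n
      - ∑ i ∈ range n, (∑ j ∈ range (i + 1), d j) * (y (i + 1) - y i) := by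
  induction n with
  | zero => simp
  | succ n ih =>
    rw [sum_range_succ, ih, sum_range_succ d (n + 1),
      sum_range_succ (fun i => (∑ j ∈ range (i + 1), d j) * (y (i + 1) - y i)) n]
    ring

/-- A nonzero operator `∑_{i ≤ n} c_i τ^i` on a finite field has at most `|Fix τ|^n` zeros. -/
theorem card_ker_sum_iterate_le {K : Type*} [Field K] [Fintype K] [DecidableEq K] (τ : K →+* K)
    (n : ℕ) (c : ℕ → K) (hc : ∃ i ≤ n, c i ≠ 0) :
    #{z : K | ∑ i ∈ range (n + 1), c i * τ^[i] z = 0} ≤ #{z : K | τ z = z} ^ n := by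
  induction n generalizing c with
  | zero =>
    obtain ⟨i, hi, hci⟩ := hc
    obtain rfl : i = 0 := by omega
    simp [hci, filter_eq']
  | succ n ih =>
    have hfix : 0 < #{z : K | τ z = z} := card_pos.2 ⟨0, by simp⟩
    by_cases hz : ∃ z₁ : K, z₁ ≠ 0 ∧ ∑ i ∈ range (n + 2), c i * τ^[i] z₁ = 0
    · obtain ⟨z₁, hz₁, hker⟩ := hz
      -- Reduction of order: put z = z₁ w. As `d` sums to 0, Abel summation factors the operator
      -- through w ↦ τ w - w and leaves one of lower order, with the partial sums of `d` as
      -- coefficients.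
      set d : ℕ → K := fun i => c i * τ^[i] z₁ with hd
      have hmul (i : ℕ) (x y : K) : τ^[i] (x * y) = τ^[i] x * τ^[i] y := iterate_map_mul τ i x y
      have hsub (i : ℕ) (x y : K) : τ^[i] (x - y) = τ^[i] x - τ^[i] y := iterate_map_sub τ i x y
      have hL (w : K) : ∑ i ∈ range (n + 2), c i * τ^[i] (z₁ * w)
          = - ∑ i ∈ range (n + 1), (∑ j ∈ range (i + 1), d j) * τ^[i] (τ w - w) := by
        have h := sum_mul_eq_neg_sum_partialSums d (fun i => τ^[i] w) (n + 1)
        rw [show ∑ i ∈ range (n + 1 + 1), d i = 0 from hker, zero_mul, zero_sub] at h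
        simp only [hsub, hmul, ← Function.iterate_succ_apply, ← mul_assoc]
        exact h
      -- If all partial sums vanished, so would every `d i`, and with it every `c i`.
      have he : ∃ i ≤ n, ∑ j ∈ range (i + 1), d j ≠ 0 := by
        by_contra! hcon
        have hall : ∀ i ≤ n + 2, ∑ j ∈ range i, d j = 0 := by
          intro i hi
          rcases i with _ | i
          · simp
          · rcases Nat.lt_or_ge n i with h | h
            · obtain rfl : i = n + 1 := by omega
              exact hker
            · exact hcon i h
        obtain ⟨i, hi, hci⟩ := hc
        have h1 := hall (i + 1) (by omega)
        rw [sum_range_succ, hall i (by omega), zero_add] at h1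
        have h2 : τ^[i] z₁ ≠ 0 := by
          intro h
          exact hz₁ ((τ.injective.iterate i) (h.trans (iterate_map_zero τ i).symm))
        exact (mul_ne_zero hci h2) h1
      have h1 : #{z : K | ∑ i ∈ range (n + 2), c i * τ^[i] z = 0} =
          #{w : K | ∑ i ∈ range (n + 1), (∑ j ∈ range (i + 1), d j) * τ^[i] (τ w - w) = 0} := by
        symm
        refine card_bij (fun w _ => z₁ * w) ?_ ?_ ?_
        · intro w hw
          simp only [mem_filter, mem_univ, true_and] at hw ⊢
          rw [hL, hw, neg_zero]
        · intro a _ b _ hab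
          exact mul_left_cancel₀ hz₁ hab
        · intro z hz
          refine ⟨z / z₁, ?_, mul_div_cancel₀ _ hz₁⟩
          simp only [mem_filter, mem_univ, true_and] at hz ⊢
          rw [← neg_eq_zero, ← hL, mul_div_cancel₀ _ hz₁, hz]
      rw [h1, pow_succ]
      refine le_trans ?_ (Nat.mul_le_mul_right _ (ih _ he))
      rw [mul_comm]
      -- A nonempty fibre of w ↦ τ w - w lies in a coset of Fix τ.
      refine card_le_mul_card_image_of_maps_to (f := fun w => τ w - w) ?_ _ ?_
      · intro w hw
        simpa using hw
      · intro b _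
        rcases (filter (fun a => τ a - a = b) ({w : K | ∑ i ∈ range (n + 1),
          (∑ j ∈ range (i + 1), d j) * τ^[i] (τ w - w) = 0} : Finset K)).eq_empty_or_nonempty with h | ⟨a, ha⟩
        · rw [h]; simp
        · refine card_le_card_of_injOn (fun x => x - a) ?_ (fun x _ y _ h => sub_left_injective h)
          intro x hx
          simp only [coe_filter, mem_filter, mem_univ, true_and, Set.mem_ofPred_eq] at ha hx ⊢
          rw [map_sub]
          linear_combination hx.2 - ha.2
    · push Not at hz
      calc _ ≤ #({0} : Finset K) := card_le_card (by
            intro z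
            simp only [mem_filter, mem_univ, true_and, mem_singleton]
            intro h
            by_contra h0
            exact hz z h0 h)
        _ = 1 := card_singleton _
        _ ≤ _ := Nat.one_le_pow _ _ hfix

theorem sum_comp_eq_sum_card {X Y M : Type*} [Fintype X] [Fintype Y] [DecidableEq Y]
    [CommRing M] (f : X → Y) (g : Y → M) :
    ∑ x, g (f x) = ∑ c, (#{x : X | f x = c} : M) * g c := by
  rw [← sum_fiberwise univ f (fun x => g (f x))]
  refine sum_congr rfl fun c _ => ?_
  rw [sum_congr rfl (g := fun _ => g c) (by simp +contextual), sum_const, nsmul_eq_mul]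

/-! ### The forms f_a and their polar operators. -/

section

variable {F K : Type*} [Field F] [Field K] [Algebra F K]

theorem exists_addChar_ne_one (F : Type*) [Field F] [Finite F] : ∃ ψ : AddChar F ℂ, ψ ≠ 1 := by
  obtain ⟨ψ, hψ⟩ := (AddChar.exists_apply_ne_zero (a := (1 : F))).2 one_ne_zero
  exact ⟨ψ, AddChar.ne_one_iff.2 ⟨1, hψ⟩⟩

/-- The quadratic form `x ↦ Tr(a x σ(x) + b x σ³(x))` attached to the pair `(a, b)`. -/
noncomputable def twistedForm (σ : K ≃ₐ[F] K) (a : K × K) (x : K) : F :=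
  Algebra.trace F K (a.1 * (x * σ x) + a.2 * (x * σ (σ (σ x))))

/-- The operator representing the polar form of `twistedForm σ a` with respect to the trace
pairing. -/
def polarOp (σ : K ≃ₐ[F] K) (a : K × K) : K →+ K where
  toFun z := a.1 * σ z + σ.symm (a.1 * z) + a.2 * σ (σ (σ z))
    + σ.symm (σ.symm (σ.symm (a.2 * z)))
  map_zero' := by simp
  map_add' x y := by simp only [mul_add, map_add]; ring

theorem polarOp_apply (σ : K ≃ₐ[F] K) (a : K × K) (z : K) :
    polarOp σ a z = a.1 * σ z + σ.symm (a.1 * z) + a.2 * σ (σ (σ z))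
    + σ.symm (σ.symm (σ.symm (a.2 * z))) := rfl

theorem twistedForm_zero (σ : K ≃ₐ[F] K) (a : K × K) : twistedForm σ a 0 = 0 := by
  simp [twistedForm]

/-- The trace is invariant under σ, so σ⁻¹ is the adjoint of σ; this moves σ and σ³ off y in the
cross terms. -/
theorem twistedForm_add (σ : K ≃ₐ[F] K) (a : K × K) (y z : K) :
    twistedForm σ a (y + z) =
      twistedForm σ a y + twistedForm σ a z + Algebra.trace F K (y * polarOp σ a z) := by
  have h1 : Algebra.trace F K (y * σ.symm (a.1 * z)) = Algebra.trace F K (a.1 * (z * σ y)) := by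
    rw [← Algebra.trace_eq_of_algEquiv σ (y * σ.symm (a.1 * z))]
    congr 1
    simp only [map_mul, AlgEquiv.apply_symm_apply]
    ring
  have h2 : Algebra.trace F K (y * σ.symm (σ.symm (σ.symm (a.2 * z))))
      = Algebra.trace F K (a.2 * (z * σ (σ (σ y)))) := by
    rw [← Algebra.trace_eq_of_algEquiv ((σ.trans σ).trans σ)
      (y * σ.symm (σ.symm (σ.symm (a.2 * z))))]
    congr 1
    simp only [AlgEquiv.trans_apply, map_mul, AlgEquiv.apply_symm_apply]
    ring
  simp only [polarOp_apply, mul_add, map_add, twistedForm]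
  rw [h1, h2]
  simp only [map_add, mul_add, add_mul]
  rw [mul_left_comm y a.1 (σ z), mul_left_comm y a.2]
  ring

/-- Apply σ to the norm equation and cancel σ(u). The consequence σ³(u) = σ(u) lets a single u scale
both terms of the form by the same constant. -/
theorem sq_apply_eq_of_norm (σ : K ≃ₐ[F] K) {u c : K} (hc : σ c = c) (hc0 : c ≠ 0)
    (hu : u * σ u = c) : σ (σ u) = u := by
  have h : σ u * σ (σ u) = c := by rw [← map_mul, hu, hc]
  have h0 : σ u ≠ 0 := by
    intro h0
    rw [h0, mul_zero] at hu
    exact hc0 hu.symm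
  apply mul_left_cancel₀ h0
  rw [h, ← hu, mul_comm]

theorem twistedForm_mul (σ : K ≃ₐ[F] K) (a : K × K) {u : K} {c : F} (hc : c ≠ 0)
    (hu : u * σ u = algebraMap F K c) (x : K) :
    twistedForm σ a (u * x) = c * twistedForm σ a x := by
  have h := sq_apply_eq_of_norm σ (σ.commutes c) (by simpa using hc) hu
  rw [twistedForm, twistedForm, ← smul_eq_mul c, ← map_smul, Algebra.smul_def, ← hu]
  congr 1
  simp only [map_mul, h]
  ring

theorem isPrimitive_compTrace [Finite F] [Finite K] {ψ : AddChar F ℂ} (hψ : ψ ≠ 1) :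
    (ψ.compAddMonoidHom (Algebra.trace F K).toAddMonoidHom).IsPrimitive := by
  apply AddChar.IsPrimitive.of_ne_one
  obtain ⟨c, hc⟩ := AddChar.ne_one_iff.1 hψ
  obtain ⟨x, hx⟩ := Algebra.trace_surjective F K c
  exact AddChar.ne_one_iff.2 ⟨x, by simpa [hx] using hc⟩

/-- The form is even, so expanding f_a(-z + z) = 0 leaves 2 f_a(z) = 0. -/
theorem twistedForm_eq_zero_of_polarOp (σ : K ≃ₐ[F] K) (hF : (2 : F) ≠ 0) (a : K × K) {z : K}
    (hz : polarOp σ a z = 0) : twistedForm σ a z = 0 := by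
  have h := twistedForm_add σ a (-z) z
  rw [hz, mul_zero, map_zero, add_zero, neg_add_cancel, twistedForm_zero] at h
  have h1 : twistedForm σ a (-z) = twistedForm σ a z := by simp [twistedForm]
  rw [h1, ← two_mul] at h
  exact (mul_eq_zero.1 h.symm).resolve_left hF

end

/-! ### The excess as a character sum. -/

section

variable {F K : Type*} [Field F] [Field K] [Fintype K] [DecidableEq K] [Algebra F K]

/-- The norm equation `u σ(u) = c` has `Q + 1` solutions for each nonzero `c` fixed by `σ`. -/
def NormRegular (σ : K ≃ₐ[F] K) (Q : ℕ) : Prop :=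
  ∀ c : K, σ c = c → c ≠ 0 → #{u : K | u * σ u = c} = Q + 1

variable {σ : K ≃ₐ[F] K} {Q : ℕ}

theorem NormRegular.exists_norm_eq (h : NormRegular σ Q) {c : F} (hc : c ≠ 0) :
    ∃ u : K, u * σ u = algebraMap F K c := by
  have h1 := h (algebraMap F K c) (σ.commutes c) (by simpa using hc)
  have h2 : 0 < #{u : K | u * σ u = algebraMap F K c} := by omega
  obtain ⟨u, hu⟩ := card_pos.1 h2
  exact ⟨u, by simpa using hu⟩

variable [DecidableEq F]

/-- The number of zeros of the form `twistedForm σ a` minus the number of places where it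
takes the value `1`. -/
noncomputable def excess (σ : K ≃ₐ[F] K) (a : K × K) : ℤ :=
  #{x : K | twistedForm σ a x = 0} - #{x : K | twistedForm σ a x = 1}

theorem NormRegular.card_twistedForm_eq (h : NormRegular σ Q) (a : K × K) {c : F} (hc : c ≠ 0) :
    #{x : K | twistedForm σ a x = c} = #{x : K | twistedForm σ a x = 1} := by
  obtain ⟨u, hu⟩ := h.exists_norm_eq hc
  have hu0 : u ≠ 0 := by
    rintro rfl
    rw [zero_mul, eq_comm, map_eq_zero] at hu
    exact hc hu
  symm
  refine card_bij (fun x _ => u * x) ?_ (fun x _ y _ hxy => mul_left_cancel₀ hu0 hxy) ?_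
  · intro x hx
    simp only [mem_filter, mem_univ, true_and] at hx ⊢
    rw [twistedForm_mul σ a hc hu, hx, mul_one]
  · intro x hx
    refine ⟨x / u, ?_, mul_div_cancel₀ _ hu0⟩
    simp only [mem_filter, mem_univ, true_and] at hx ⊢
    have := twistedForm_mul σ a hc hu (x / u)
    rw [mul_div_cancel₀ _ hu0, hx] at this
    exact (mul_left_cancel₀ hc (by rw [mul_one]; exact this)).symm

variable [Fintype F]

theorem NormRegular.sum_comp_twistedForm (h : NormRegular σ Q) {M : Type*} [CommRing M]
    (a : K × K) (g : F → M) :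
    ∑ x, g (twistedForm σ a x) =
      (excess σ a : M) * g 0 + #{x : K | twistedForm σ a x = 1} * ∑ c, g c := by
  rw [sum_comp_eq_sum_card, ← add_sum_erase _ _ (mem_univ (0 : F)),
    ← add_sum_erase _ g (mem_univ (0 : F)), mul_add, ← add_assoc, mul_sum, excess]
  congr 1
  · push_cast
    ring
  · refine sum_congr rfl fun c hc => ?_
    rw [h.card_twistedForm_eq a (ne_of_mem_erase hc)]

theorem NormRegular.card_eq (h : NormRegular σ Q) (a : K × K) :
    (Fintype.card K : ℤ) =
      excess σ a + #{x : K | twistedForm σ a x = 1} * Fintype.card F := by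
  simpa using h.sum_comp_twistedForm (M := ℤ) a (fun _ => 1)

theorem NormRegular.sum_addChar (h : NormRegular σ Q) (a : K × K) {ψ : AddChar F ℂ} (hψ : ψ ≠ 1) :
    ∑ x, ψ (twistedForm σ a x) = excess σ a := by
  rw [h.sum_comp_twistedForm a ψ, AddChar.sum_eq_zero_of_ne_one hψ]
  simp

/-- The sums for ψ and ψ⁻¹ are the same integer, so the square is their product. Substituting x = y
+ z makes the inner sum over y a character sum of y · `polarOp σ a z`, which vanishes unless z is in
the kernel, where the form is 0. -/
theorem NormRegular.excess_sq (h : NormRegular σ Q) (hF : (2 : F) ≠ 0) (a : K × K) :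
    excess σ a ^ 2 = Fintype.card K * #{z : K | polarOp σ a z = 0} := by
  obtain ⟨ψ, hψ⟩ : ∃ ψ : AddChar F ℂ, ψ ≠ 1 := exists_addChar_ne_one F
  have hprim := isPrimitive_compTrace (K := K) hψ
  have hψ' : ψ⁻¹ ≠ 1 := inv_ne_one.2 hψ
  have key : ((excess σ a : ℤ) : ℂ) ^ 2 = Fintype.card K * #{z : K | polarOp σ a z = 0} := by
    calc ((excess σ a : ℤ) : ℂ) ^ 2
        = (∑ y, ψ⁻¹ (twistedForm σ a y)) * ∑ x, ψ (twistedForm σ a x) := by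
          rw [h.sum_addChar a hψ, h.sum_addChar a hψ', sq]
      _ = ∑ y, ∑ z, ψ (-twistedForm σ a y) * ψ (twistedForm σ a (y + z)) := by
          rw [sum_mul]
          refine sum_congr rfl fun y _ => ?_
          rw [AddChar.inv_apply, mul_sum]
          exact (Equiv.sum_comp (Equiv.addLeft y)
            (fun x => ψ (-twistedForm σ a y) * ψ (twistedForm σ a x))).symm
      _ = ∑ z, ψ (twistedForm σ a z) * ∑ y, ψ.compAddMonoidHom
            (Algebra.trace F K).toAddMonoidHom (y * polarOp σ a z) := by
          rw [sum_comm]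
          refine sum_congr rfl fun z _ => ?_
          rw [mul_sum]
          refine sum_congr rfl fun y _ => ?_
          rw [← AddChar.map_add_eq_mul, AddChar.compAddMonoidHom_apply,
            ← AddChar.map_add_eq_mul, twistedForm_add]
          congr 1
          simp
          ring
      _ = ∑ z, if polarOp σ a z = 0 then (Fintype.card K : ℂ) else 0 := by
          refine sum_congr rfl fun z _ => ?_
          rw [AddChar.sum_mulShift _ hprim]
          split_ifs with hz
          · rw [twistedForm_eq_zero_of_polarOp σ hF a hz]
            simp
          · simp
      _ = _ := by
          rw [← sum_filter, sum_const, nsmul_eq_mul, mul_comm]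
  exact_mod_cast key

end

/-! ### The possible values of the excess. -/

section

variable {F K : Type*} [Field F] [Field K] [Algebra F K]

/-- The polar operator commutes with scalars fixed by `σ²`, up to applying `σ`. -/
theorem polarOp_mul (σ : K ≃ₐ[F] K) (a : K × K) {e : K} (he : σ (σ e) = e) (z : K) :
    polarOp σ a (e * z) = σ e * polarOp σ a z := by
  have h1 : σ.symm e = σ e := by rw [AlgEquiv.symm_apply_eq, he]
  have h2 : σ.symm (σ e) = e := σ.symm_apply_apply e
  simp only [polarOp_apply, map_mul, h1, h2, he]
  ring

/-- The kernel of the polar operator, as a subspace over the fixed field of `σ²`. -/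
def polarKer (σ : K ≃ₐ[F] K) (a : K × K) :
    Submodule (((σ.trans σ : K ≃ₐ[F] K) : K →+* K).eqLocusField (RingHom.id K)) K where
  carrier := {z | polarOp σ a z = 0}
  zero_mem' := map_zero _
  add_mem' {x y} hx hy := by
    change polarOp σ a (x + y) = 0
    rw [map_add, show polarOp σ a x = 0 from hx, show polarOp σ a y = 0 from hy, add_zero]
  smul_mem' e z hz := by
    change polarOp σ a ((e : K) * z) = 0
    rw [polarOp_mul σ a (show σ (σ (e : K)) = e from e.2), show polarOp σ a z = 0 from hz, mul_zero]

/-- Applying σ³ clears the inverses and leaves the even powers 1, σ², σ⁴, σ⁶, hence a polynomial of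
degree 3 in τ = σ². -/
theorem polarOp_eq_zero_iff (σ : K ≃ₐ[F] K) (a : K × K) (z : K) :
    polarOp σ a z = 0 ↔ ∑ i ∈ range 4, ![a.2, σ (σ a.1), σ (σ (σ a.1)), σ (σ (σ a.2))]
      (Fin.ofNat 4 i) * ((σ.trans σ : K ≃ₐ[F] K) : K →+* K)^[i] z = 0 := by
  have hinj : Function.Injective fun x => σ (σ (σ x)) :=
    (σ.injective.comp σ.injective).comp σ.injective
  rw [← hinj.eq_iff]
  simp only [polarOp_apply, map_add, map_mul, AlgEquiv.apply_symm_apply, map_zero]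
  simp [sum_range_succ, Fin.ofNat]
  ring_nf

end

section

variable {F K : Type*} [Field F] [Field K] [Fintype K] [DecidableEq K] [Algebra F K]
  {σ : K ≃ₐ[F] K} {Q N : ℕ}

theorem exists_card_polarKer (hE : #{x : K | σ (σ x) = x} = Q ^ 2) (a : K × K) :
    ∃ d : ℕ, #{z : K | polarOp σ a z = 0} = (Q ^ 2) ^ d := by
  classical
  have h := Module.card_eq_pow_finrank
    (K := ((σ.trans σ : K ≃ₐ[F] K) : K →+* K).eqLocusField (RingHom.id K)) (V := polarKer σ a)
  have h1 : #{z : K | polarOp σ a z = 0} = Fintype.card (polarKer σ a) := by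
    rw [← Fintype.card_subtype]
    exact Fintype.card_congr (Equiv.refl _)
  have h2 : #{x : K | σ (σ x) = x} =
      Fintype.card (((σ.trans σ : K ≃ₐ[F] K) : K →+* K).eqLocusField (RingHom.id K)) := by
    rw [← Fintype.card_subtype]
    exact Fintype.card_congr (Equiv.refl _)
  exact ⟨_, by rw [h1, h, ← h2, hE]⟩

theorem card_polarOp_le (hE : #{x : K | σ (σ x) = x} = Q ^ 2) {a : K × K} (ha : a ≠ 0) :
    #{z : K | polarOp σ a z = 0} ≤ (Q ^ 2) ^ 3 := by
  rw [← hE]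
  have h := card_ker_sum_iterate_le ((σ.trans σ : K ≃ₐ[F] K) : K →+* K) 3
    (fun i => ![a.2, σ (σ a.1), σ (σ (σ a.1)), σ (σ (σ a.2))] (Fin.ofNat 4 i)) (by
      by_cases h2 : a.2 = 0
      · refine ⟨1, by norm_num, ?_⟩
        have h1 : a.1 ≠ 0 := fun h1 => ha (Prod.ext h1 h2)
        simpa [Fin.ofNat] using h1
      · exact ⟨0, by norm_num, by simpa [Fin.ofNat] using h2⟩)
  rw [filter_congr fun z _ => polarOp_eq_zero_iff σ a z]
  exact h

/-- The norm-one group acts freely on the nonzero elements of the level sets of the form. -/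
theorem NormRegular.dvd_card (h : NormRegular σ Q) (s : Finset K) (h0 : 0 ∉ s)
    (hs : ∀ u x : K, u * σ u = 1 → x ∈ s → u * x ∈ s) : Q + 1 ∣ #s := by
  -- Each nonempty fibre of x ↦ x σ(x) on `s` is a full orbit of the norm-one group.
  have h1 : ∀ b ∈ s.image (fun x => x * σ x), #{x ∈ s | x * σ x = b} = Q + 1 := by
    intro b hb
    obtain ⟨y, hy, rfl⟩ := mem_image.1 hb
    have hy0 : y ≠ 0 := fun h => h0 (h ▸ hy)
    have hσy : σ y ≠ 0 := by simpa using hy0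
    rw [← h 1 (map_one σ) one_ne_zero]
    symm
    refine card_bij (fun u _ => u * y) ?_ (fun u _ v _ huv => mul_right_cancel₀ hy0 huv) ?_
    · intro u hu
      simp only [mem_filter, mem_univ, true_and] at hu ⊢
      refine ⟨hs u y hu hy, ?_⟩
      rw [map_mul]
      linear_combination (y * σ y) * hu
    · intro x hx
      simp only [mem_filter, mem_univ, true_and] at hx ⊢
      refine ⟨x / y, ?_, div_mul_cancel₀ _ hy0⟩
      rw [map_div₀]
      field_simp
      exact hx.2
  rw [card_eq_sum_card_image (fun x => x * σ x) s, sum_congr rfl h1, sum_const, smul_eq_mul]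
  exact dvd_mul_left _ _

variable [DecidableEq F]

/-- Both level sets are unions of free orbits of size Q + 1, except for the point 0, which lies in
the zero set and accounts for the 1. -/
theorem NormRegular.dvd_excess_sub_one (h : NormRegular σ Q) (a : K × K) :
    ((Q : ℤ) + 1) ∣ excess σ a - 1 := by
  have hinv {u : K} (hu : u * σ u = 1) (x : K) : twistedForm σ a (u * x) = twistedForm σ a x := by
    have := twistedForm_mul σ a (one_ne_zero (α := F)) (by rw [hu, map_one]) x
    rwa [one_mul] at this
  have h1 : Q + 1 ∣ #{x : K | twistedForm σ a x = 1} := by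
    refine h.dvd_card _ (by simp [twistedForm_zero]) ?_
    intro u x hu hx
    simpa [hinv hu] using hx
  have h2 : Q + 1 ∣ #(({x : K | twistedForm σ a x = 0} : Finset K).erase 0) := by
    refine h.dvd_card _ (by simp) ?_
    intro u x hu hx
    simp only [mem_erase, mem_filter, mem_univ, true_and, hinv hu] at hx ⊢
    refine ⟨mul_ne_zero ?_ hx.1, hx.2⟩
    rintro rfl
    simp at hu
  have h3 : #({x : K | twistedForm σ a x = 0} : Finset K)
      = #(({x : K | twistedForm σ a x = 0} : Finset K).erase 0) + 1 :=
    (card_erase_add_one (by simp [twistedForm_zero])).symm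
  rw [excess, h3]
  have h1' : ((Q : ℤ) + 1) ∣ #{x : K | twistedForm σ a x = 1} := by exact_mod_cast h1
  have h2' : ((Q : ℤ) + 1) ∣ #(({x : K | twistedForm σ a x = 0} : Finset K).erase 0) := by
    exact_mod_cast h2
  obtain ⟨k₁, hk₁⟩ := h1'
  obtain ⟨k₂, hk₂⟩ := h2'
  refine ⟨k₂ - k₁, ?_⟩
  rw [hk₁]
  push_cast
  rw [hk₂]
  ring

/-- Since -Q ≡ 1 mod Q + 1, the opposite sign would force Q + 1 to divide 2. -/
theorem eq_neg_pow_of_sq_eq {Q : ℕ} (hQ : 1 < Q) {S : ℤ} {n : ℕ} (hS : S ^ 2 = ((Q : ℤ) ^ n) ^ 2)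
    (hd : ((Q : ℤ) + 1) ∣ S - 1) : S = (-(Q : ℤ)) ^ n := by
  have h1 : S ^ 2 = ((-(Q : ℤ)) ^ n) ^ 2 := by
    rw [hS, ← pow_mul, ← pow_mul, mul_comm n 2, pow_mul, pow_mul, neg_sq]
  have h2 : ((Q : ℤ) + 1) ∣ (-(Q : ℤ)) ^ n - 1 := by
    have := sub_dvd_pow_sub_pow (-(Q : ℤ)) 1 n
    rw [one_pow] at this
    rw [← neg_dvd]
    convert this using 1
    ring
  rcases sq_eq_sq_iff_eq_or_eq_neg.1 h1 with h | h
  · exact h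
  · exfalso
    rw [h] at hd
    have h3 := dvd_add hd h2
    have h4 : ((Q : ℤ) + 1) ∣ 2 := by
      rw [← dvd_neg]
      convert h3 using 1
      ring
    have := Int.le_of_dvd (by norm_num) h4
    omega

theorem NormRegular.exists_excess_eq [Fintype F] (h : NormRegular σ Q) (hF : (2 : F) ≠ 0) (hQ : 1 < Q)
    (hE : #{x : K | σ (σ x) = x} = Q ^ 2) (hK : Fintype.card K = Q ^ (2 * N)) {a : K × K}
    (ha : a ≠ 0) : ∃ i : Fin 4, excess σ a = (-(Q : ℤ)) ^ (N + i) := by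
  obtain ⟨d, hd⟩ := exists_card_polarKer hE a
  have hd4 : d < 4 := by
    have h1 := card_polarOp_le hE ha
    rw [hd] at h1
    have := (Nat.pow_le_pow_iff_right (Nat.one_lt_pow two_ne_zero hQ)).1 h1
    omega
  refine ⟨⟨d, hd4⟩, eq_neg_pow_of_sq_eq hQ ?_ (h.dvd_excess_sub_one a)⟩
  rw [h.excess_sq hF a, hd, hK]
  push_cast
  ring

end

/-! ### Common zeros of ∑ xⱼ σ(xⱼ) and ∑ xⱼ σ³(xⱼ). -/

/-- Counting the zeros of a homogeneous condition on `V × K` by the last coordinate. -/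
theorem card_homogeneous {K V : Type*} [Field K] [Fintype K] [DecidableEq K] [AddCommGroup V]
    [Module K V] [Fintype V] (P : V × K → Prop) [DecidablePred P]
    (hP : ∀ (c : K) (v : V × K), c ≠ 0 → P v → P (c • v)) :
    #{v : V × K | P v} =
      #{v : V | P (v, 0)} + (Fintype.card K - 1) * #{v : V | P (v, 1)} := by
  have h1 : #{v : V × K | P v} = ∑ z : K, #{v : V | P (v, z)} := by
    simp only [card_filter]
    rw [Fintype.sum_prod_type_right]
  rw [h1, ← add_sum_erase _ _ (mem_univ (0 : K))]
  congr 1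
  rw [sum_congr rfl (g := fun _ => #{v : V | P (v, 1)}), sum_const, card_erase_of_mem (mem_univ _),
    card_univ, smul_eq_mul]
  intro z hz
  have hz0 := ne_of_mem_erase hz
  symm
  refine card_bij (fun v _ => z • v) ?_ (fun v _ w _ h => smul_right_injective V hz0 h) ?_
  · intro v hv
    simp only [mem_filter, mem_univ, true_and] at hv ⊢
    simpa using hP z _ hz0 hv
  · intro v hv
    simp only [mem_filter, mem_univ, true_and] at hv ⊢
    refine ⟨z⁻¹ • v, ?_, smul_inv_smul₀ hz0 v⟩
    simpa [hz0] using hP z⁻¹ _ (inv_ne_zero hz0) hv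

section

variable {F K : Type*} [Field F] [Field K] [Algebra F K]

/-- If `(t, s, 1)` is orthogonal to its images under `σ` and `σ³`, then it is fixed by `σ²`. -/
theorem sq_apply_eq_of_isotropic (σ : K ≃ₐ[F] K) {t s : K} (h₁ : t * σ t + s * σ s + 1 = 0)
    (h₃ : t * σ (σ (σ t)) + s * σ (σ (σ s)) + 1 = 0) : σ (σ t) = t ∧ σ (σ s) = s := by
  have e₁ : σ t * σ (σ t) + σ s * σ (σ s) + 1 = 0 := by simpa using congrArg σ h₁
  have e₂ : σ (σ t) * σ (σ (σ t)) + σ (σ s) * σ (σ (σ s)) + 1 = 0 := by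
    simpa using congrArg σ e₁
  have r₁ : (σ (σ t) - t) * σ t + (σ (σ s) - s) * σ s = 0 := by linear_combination e₁ - h₁
  have r₃ : (σ (σ t) - t) * σ (σ (σ t)) + (σ (σ s) - s) * σ (σ (σ s)) = 0 := by
    linear_combination e₂ - h₃
  by_cases hdet : σ t * σ (σ (σ s)) - σ (σ (σ t)) * σ s = 0
  · have hdet' : t * σ (σ s) - σ (σ t) * s = 0 := by
      apply σ.injective
      simpa using hdet
    constructor
    · linear_combination -t * r₁ + (σ (σ t) - t) * h₁ + σ s * hdet'
    · linear_combination -s * r₁ + (σ (σ s) - s) * h₁ - σ t * hdet'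
  · constructor
    · apply sub_eq_zero.1
      apply (mul_eq_zero.1 _).resolve_right hdet
      linear_combination σ (σ (σ s)) * r₁ - σ s * r₃
    · apply sub_eq_zero.1
      apply (mul_eq_zero.1 _).resolve_right hdet
      linear_combination σ t * r₃ - σ (σ (σ t)) * r₁

end

section

variable {F K : Type*} [Field F] [Field K] [Fintype K] [DecidableEq K] [Algebra F K]
  {σ : K ≃ₐ[F] K} {Q : ℕ}

theorem NormRegular.card_norm_eq_neg_one (h : NormRegular σ Q) :
    #{t : K | t * σ t + 1 = 0} = Q + 1 := by
  rw [← h (-1) (by simp) (by simp)]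
  simp only [eq_neg_iff_add_eq_zero]

/-- With the second coordinate scaled to 1, the first equation says that t has norm -1; then σ³(t) =
σ(t) and the second equation is automatic. -/
theorem NormRegular.card_isotropic_two (h : NormRegular σ Q) :
    #{v : K × K | v.1 * σ v.1 + v.2 * σ v.2 = 0 ∧
      v.1 * σ (σ (σ v.1)) + v.2 * σ (σ (σ v.2)) = 0} = 1 + (Fintype.card K - 1) * (Q + 1) := by
  rw [card_homogeneous]
  · congr 2
    · simp [filter_eq']
    · rw [← h.card_norm_eq_neg_one]
      congr 1
      ext t
      simp only [mem_filter, mem_univ, true_and, map_one, mul_one]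
      refine and_iff_left_of_imp fun ht => ?_
      rw [sq_apply_eq_of_norm σ (c := -1) (by simp) (by simp) (eq_neg_of_add_eq_zero_left ht), ht]
  · rintro c ⟨x, y⟩ - ⟨h₁, h₃⟩
    simp only [Prod.smul_mk, smul_eq_mul, map_mul] at h₁ h₃ ⊢
    constructor
    · linear_combination c * σ c * h₁
    · linear_combination c * σ (σ (σ c)) * h₃

/-- The number of affine points of the Hermitian curve. -/
theorem NormRegular.card_hermitian (h : NormRegular σ Q) (hE : #{x : K | σ (σ x) = x} = Q ^ 2) :
    #{v : K × K | v.1 * σ v.1 + v.2 * σ v.2 + 1 = 0 ∧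
      v.1 * σ (σ (σ v.1)) + v.2 * σ (σ (σ v.2)) + 1 = 0} + Q = Q ^ 3 := by
  -- Solutions have t fixed by σ², and s has norm -(1 + t σ(t)). Of the Q² such t, Q + 1 make this 0
  -- and allow only s = 0; the others allow Q + 1 values. The total is (Q + 1)(Q² - Q) = Q³ - Q.
  have h1 : #{v : K × K | v.1 * σ v.1 + v.2 * σ v.2 + 1 = 0 ∧
      v.1 * σ (σ (σ v.1)) + v.2 * σ (σ (σ v.2)) + 1 = 0} =
      ∑ t : K, if σ (σ t) = t then (if t * σ t + 1 = 0 then 1 else Q + 1) else 0 := by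
    rw [card_filter, Fintype.sum_prod_type]
    refine sum_congr rfl fun t _ => ?_
    rw [← card_filter]
    split_ifs with ht h0
    · rw [card_eq_one]
      refine ⟨0, ?_⟩
      ext s
      simp only [mem_filter, mem_univ, true_and, mem_singleton]
      constructor
      · rintro ⟨h₁, -⟩
        have : s * σ s = 0 := by linear_combination h₁ - h0
        simpa using this
      · rintro rfl
        simp [ht, h0]
    · rw [← h (-(t * σ t + 1)) (by simp [ht, mul_comm]) (neg_ne_zero.2 h0)]
      congr 1
      ext s
      simp only [mem_filter, mem_univ, true_and]
      constructor
      · rintro ⟨h₁, -⟩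
        linear_combination h₁
      · intro hs
        have h2 := sq_apply_eq_of_norm σ (by simp [ht, mul_comm]) (neg_ne_zero.2 h0) hs
        rw [ht, h2]
        constructor <;> linear_combination hs
    · rw [card_eq_zero, filter_eq_empty_iff]
      rintro s - ⟨h₁, h₃⟩
      exact ht (sq_apply_eq_of_isotropic σ h₁ h₃).1
  have h2 : #{t : K | σ (σ t) = t ∧ t * σ t + 1 = 0} = Q + 1 := by
    rw [← h.card_norm_eq_neg_one]
    congr 1
    ext t
    simp only [mem_filter, mem_univ, true_and]
    refine and_iff_right_of_imp fun ht => ?_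
    exact sq_apply_eq_of_norm σ (c := -1) (by simp) (by simp) (eq_neg_of_add_eq_zero_left ht)
  have h3 : #{t : K | σ (σ t) = t ∧ t * σ t + 1 = 0} + #{t : K | σ (σ t) = t ∧ ¬ t * σ t + 1 = 0}
      = Q ^ 2 := by
    rw [← hE, ← filter_filter, ← filter_filter]
    exact card_filter_add_card_filter_not _
  rw [h1, ← sum_filter, sum_ite, filter_filter, filter_filter, sum_const, sum_const, h2]
  rw [h2] at h3
  simp only [smul_eq_mul]
  generalize #{t : K | σ (σ t) = t ∧ ¬ t * σ t + 1 = 0} = w at h3 ⊢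
  zify at h3 ⊢
  linear_combination ((Q : ℤ) + 1) * h3

theorem NormRegular.card_isotropic_three (h : NormRegular σ Q)
    (hE : #{x : K | σ (σ x) = x} = Q ^ 2) :
    #{v : (K × K) × K | v.1.1 * σ v.1.1 + v.1.2 * σ v.1.2 + v.2 * σ v.2 = 0 ∧
      v.1.1 * σ (σ (σ v.1.1)) + v.1.2 * σ (σ (σ v.1.2)) + v.2 * σ (σ (σ v.2)) = 0}
      = 1 + (Fintype.card K - 1) * (Q ^ 3 + 1) := by
  rw [card_homogeneous]
  · have h2 := h.card_isotropic_two
    have h3 := h.card_hermitian hE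
    simp only [map_zero, mul_zero, add_zero, map_one, mul_one]
    rw [h2, ← h3]
    ring
  · rintro c ⟨⟨x, y⟩, z⟩ - ⟨h₁, h₃⟩
    simp only [Prod.smul_mk, smul_eq_mul, map_mul] at h₁ h₃ ⊢
    constructor
    · linear_combination c * σ c * h₁
    · linear_combination c * σ (σ (σ c)) * h₃

/-! ### Power moments of the excess. -/

theorem sum_addChar_pair {ι : Type*} [Fintype ι] {χ : AddChar K ℂ} (hχ : χ.IsPrimitive)
    (A B : ι → K) : ∑ a : K × K, ∑ i, χ (a.1 * A i + a.2 * B i) =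
      (Fintype.card K : ℂ) ^ 2 * #{i | A i = 0 ∧ B i = 0} := by
  rw [sum_comm, card_filter]
  push_cast
  rw [mul_sum]
  refine sum_congr rfl fun i _ => ?_
  simp only [AddChar.map_add_eq_mul]
  rw [Fintype.sum_prod_type]
  simp only [← mul_sum]
  rw [← sum_mul, AddChar.sum_mulShift _ hχ, AddChar.sum_mulShift _ hχ]
  by_cases hA : A i = 0 <;> by_cases hB : B i = 0 <;> simp [hA, hB, sq]

variable [DecidableEq F] [Fintype F]

theorem NormRegular.excess_eq_sum (h : NormRegular σ Q) {ψ : AddChar F ℂ} (hψ : ψ ≠ 1)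
    (a : K × K) : (excess σ a : ℂ) = ∑ x, ψ.compAddMonoidHom (Algebra.trace F K).toAddMonoidHom
      (a.1 * (x * σ x) + a.2 * (x * σ (σ (σ x)))) :=
  (h.sum_addChar a hψ).symm

theorem NormRegular.sum_excess (h : NormRegular σ Q) :
    ∑ a, excess σ a = (Fintype.card K : ℤ) ^ 2 := by
  obtain ⟨ψ, hψ⟩ := exists_addChar_ne_one F
  have key : ∑ a, (excess σ a : ℂ) = (Fintype.card K : ℂ) ^ 2 := by
    simp only [h.excess_eq_sum hψ]
    rw [sum_addChar_pair (isPrimitive_compTrace hψ)]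
    simp [filter_eq']
  exact_mod_cast key

/-- A power of S(a) is a character sum over tuples that is linear in a, so summing over a leaves
|K|² times the number of isotropic tuples. The cube is treated in the same way. -/
theorem NormRegular.sum_excess_sq (h : NormRegular σ Q) :
    ∑ a, excess σ a ^ 2 =
      (Fintype.card K : ℤ) ^ 2 * (1 + ((Fintype.card K : ℤ) - 1) * (Q + 1)) := by
  obtain ⟨ψ, hψ⟩ := exists_addChar_ne_one F
  have key : ∑ a, (excess σ a : ℂ) ^ 2 = (Fintype.card K : ℂ) ^ 2 *
      (1 + (Fintype.card K - 1 : ℕ) * (Q + 1)) := by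
    have h2 : ∀ a : K × K, (excess σ a : ℂ) ^ 2 = ∑ v : K × K,
        ψ.compAddMonoidHom (Algebra.trace F K).toAddMonoidHom
        (a.1 * (v.1 * σ v.1 + v.2 * σ v.2)
          + a.2 * (v.1 * σ (σ (σ v.1)) + v.2 * σ (σ (σ v.2)))) := by
      intro a
      rw [sq, h.excess_eq_sum hψ, sum_mul_sum, ← sum_product', univ_product_univ]
      refine sum_congr rfl fun v _ => ?_
      rw [← AddChar.map_add_eq_mul]
      congr 1
      ring
    simp only [h2]
    rw [sum_addChar_pair (isPrimitive_compTrace hψ), h.card_isotropic_two]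
    push_cast
    rfl
  rw [Nat.cast_sub Fintype.card_pos] at key
  exact_mod_cast key

theorem NormRegular.sum_excess_cube (h : NormRegular σ Q)
    (hE : #{x : K | σ (σ x) = x} = Q ^ 2) :
    ∑ a, excess σ a ^ 3 =
      (Fintype.card K : ℤ) ^ 2 * (1 + ((Fintype.card K : ℤ) - 1) * (Q ^ 3 + 1)) := by
  obtain ⟨ψ, hψ⟩ := exists_addChar_ne_one F
  have key : ∑ a, (excess σ a : ℂ) ^ 3 = (Fintype.card K : ℂ) ^ 2 *
      (1 + (Fintype.card K - 1 : ℕ) * (Q ^ 3 + 1)) := by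
    have h2 : ∀ a : K × K, (excess σ a : ℂ) ^ 3 = ∑ v : (K × K) × K,
        ψ.compAddMonoidHom (Algebra.trace F K).toAddMonoidHom
        (a.1 * (v.1.1 * σ v.1.1 + v.1.2 * σ v.1.2 + v.2 * σ v.2)
          + a.2 * (v.1.1 * σ (σ (σ v.1.1)) + v.1.2 * σ (σ (σ v.1.2))
            + v.2 * σ (σ (σ v.2)))) := by
      intro a
      rw [pow_succ, sq, h.excess_eq_sum hψ, sum_mul_sum, ← sum_product', univ_product_univ,
        sum_mul_sum, ← sum_product', univ_product_univ]
      refine sum_congr rfl fun v _ => ?_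
      rw [← AddChar.map_add_eq_mul, ← AddChar.map_add_eq_mul]
      congr 1
      ring
    simp only [h2]
    rw [sum_addChar_pair (isPrimitive_compTrace hψ), h.card_isotropic_three hE]
    push_cast
    rfl
  rw [Nat.cast_sub Fintype.card_pos] at key
  exact_mod_cast key

end

/-! ### Solving the moment equations. -/

section Frequencies

/-- With N = M + 4 no exponent subtraction in the numerators truncates, and each of the four becomes
a polynomial in Q and H = Q^M. -/
theorem freqNum_zero_eq (p δ M : ℕ) (ε : ℚ) {Q H : ℚ} (hQ : (p : ℚ) ^ δ = Q) (hH : Q ^ M = H) :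
    freqNum p (δ * (2 * (M + 4))) δ ε 0 =
      H ^ 4 * Q ^ 22 - H ^ 4 * Q ^ 20 - H ^ 4 * Q ^ 17 + H ^ 2 * Q ^ 12 + H ^ 2 * Q ^ 9 - Q ^ 6
        + ε * (H ^ 3 * Q ^ 17 - H ^ 3 * Q ^ 16 - H * Q ^ 9 + H * Q ^ 8) := by
  have hm : δ * (2 * (M + 4)) / 2 = δ * (M + 4) := by
    rw [mul_left_comm, Nat.mul_div_cancel_left _ two_pos]
  simp only [freqNum, Matrix.cons_val, hm]
  subst hH hQ
  simp only [← pow_mul, ← pow_add]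
  ring_nf

theorem freqNum_one_eq (p δ M : ℕ) (ε : ℚ) {Q H : ℚ} (hQ : (p : ℚ) ^ δ = Q) (hH : Q ^ M = H) :
    freqNum p (δ * (2 * (M + 4))) δ ε 1 =
      H ^ 4 * Q ^ 14 * (Q ^ 7 - Q ^ 2 - 1) + H ^ 2 * Q ^ 6 * (Q ^ 5 - Q ^ 6 + Q ^ 2 + 1)
        - Q ^ 3 * (Q ^ 2 - Q + 1)
        - ε * (H ^ 3 * Q ^ 12 - H * Q ^ 4) * (-1 + Q - Q ^ 2 + Q ^ 3 - Q ^ 4 + Q ^ 5) := by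
  have hm : δ * (2 * (M + 4)) / 2 = δ * (M + 4) := by
    rw [mul_left_comm, Nat.mul_div_cancel_left _ two_pos]
  have e₁ : 2 * (δ * (2 * (M + 4))) - 2 * δ = δ * (4 * M + 14) :=
    Nat.sub_eq_of_eq_add (by ring)
  have e₂ : δ * (2 * (M + 4)) - 2 * δ = δ * (2 * M + 6) := Nat.sub_eq_of_eq_add (by ring)
  simp only [freqNum, Matrix.cons_val, hm, e₁, e₂, altSum, sum_range_succ, range_zero, sum_empty]
  subst hH hQ
  simp only [← pow_mul, ← pow_add]
  ring_nf

theorem freqNum_two_eq (p δ M : ℕ) (ε : ℚ) {Q H : ℚ} (hQ : (p : ℚ) ^ δ = Q) (hH : Q ^ M = H) :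
    freqNum p (δ * (2 * (M + 4))) δ ε 2 =
      H ^ 4 * Q ^ 13 * (Q ^ 5 + Q - 1) - H ^ 2 * Q ^ 5 * (Q ^ 6 + Q ^ 4 + Q - 1)
        + Q * (Q ^ 2 - Q + 1)
        + ε * (H ^ 3 * Q ^ 10 - H * Q ^ 2) * (-1 + Q - Q ^ 2 + Q ^ 3 - Q ^ 4 + Q ^ 5) := by
  have hm : δ * (2 * (M + 4)) / 2 = δ * (M + 4) := by
    rw [mul_left_comm, Nat.mul_div_cancel_left _ two_pos]
  have e₁ : 2 * (δ * (2 * (M + 4))) - 3 * δ = δ * (4 * M + 13) :=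
    Nat.sub_eq_of_eq_add (by ring)
  have e₂ : δ * (2 * (M + 4)) - 3 * δ = δ * (2 * M + 5) := Nat.sub_eq_of_eq_add (by ring)
  have e₃ : 3 * (δ * (M + 4)) - 2 * δ = δ * (3 * M + 10) := Nat.sub_eq_of_eq_add (by ring)
  have e₄ : δ * (M + 4) - 2 * δ = δ * (M + 2) := Nat.sub_eq_of_eq_add (by ring)
  simp only [freqNum, Matrix.cons_val, hm, e₁, e₂, e₃, e₄, altSum, sum_range_succ, range_zero,
    sum_empty]
  subst hH hQ
  simp only [← pow_mul, ← pow_add]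
  ring_nf

theorem freqNum_three_eq (p δ M : ℕ) (ε : ℚ) {Q H : ℚ} (hQ : (p : ℚ) ^ δ = Q)
    (hH : Q ^ M = H) :
    freqNum p (δ * (2 * (M + 4))) δ ε 3 =
      H ^ 4 * Q ^ 13 - H ^ 2 * Q ^ 8 - H ^ 2 * Q ^ 5 + 1
        - ε * (H ^ 3 * Q ^ 11 - H ^ 3 * Q ^ 10 - H * Q ^ 3 + H * Q ^ 2) := by
  have hm : δ * (2 * (M + 4)) / 2 = δ * (M + 4) := by
    rw [mul_left_comm, Nat.mul_div_cancel_left _ two_pos]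
  have e₁ : 2 * (δ * (2 * (M + 4))) - 3 * δ = δ * (4 * M + 13) :=
    Nat.sub_eq_of_eq_add (by ring)
  have e₂ : δ * (2 * (M + 4)) - 3 * δ = δ * (2 * M + 5) := Nat.sub_eq_of_eq_add (by ring)
  have e₃ : 3 * (δ * (M + 4)) - 2 * δ = δ * (3 * M + 10) := Nat.sub_eq_of_eq_add (by ring)
  have e₄ : δ * (M + 4) - 2 * δ = δ * (M + 2) := Nat.sub_eq_of_eq_add (by ring)
  have e₅ : 3 * (δ * (M + 4)) - δ = δ * (3 * M + 11) := Nat.sub_eq_of_eq_add (by ring)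
  have e₆ : δ * (M + 4) - δ = δ * (M + 3) := Nat.sub_eq_of_eq_add (by ring)
  simp only [freqNum, Matrix.cons_val, hm, e₁, e₂, e₃, e₄, e₅, e₆]
  subst hH hQ
  simp only [← pow_mul, ← pow_add]
  ring_nf

/-- The moment equations determine the frequencies. -/
theorem eq_freqNum_of_moments {p δ M : ℕ} (hp : 0 < p) {ε : ℚ} (hε : ε ^ 2 = 1) {h : ℚ}
    (hh : h = ((p : ℚ) ^ δ) ^ (M + 4)) (f : Fin 4 → ℚ)
    (h₀ : ∑ i, f i = h ^ 4 - 1)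
    (h₁ : ∑ i : Fin 4, f i * (ε * h * (-(p : ℚ) ^ δ) ^ (i : ℕ)) = h ^ 4 - h ^ 2)
    (h₂ : ∑ i : Fin 4, f i * (ε * h * (-(p : ℚ) ^ δ) ^ (i : ℕ)) ^ 2 =
      h ^ 4 * (1 + (h ^ 2 - 1) * ((p : ℚ) ^ δ + 1)) - (h ^ 2) ^ 2)
    (h₃ : ∑ i : Fin 4, f i * (ε * h * (-(p : ℚ) ^ δ) ^ (i : ℕ)) ^ 3 =
      h ^ 4 * (1 + (h ^ 2 - 1) * (((p : ℚ) ^ δ) ^ 3 + 1)) - (h ^ 2) ^ 3) (i : Fin 4) :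
    freqDen p δ * f i = freqNum p (δ * (2 * (M + 4))) δ ε i := by
  have hp0 : (p : ℚ) ≠ 0 := by positivity
  obtain ⟨Q, hQ⟩ : ∃ Q : ℚ, (p : ℚ) ^ δ = Q := ⟨_, rfl⟩
  obtain ⟨H, hH⟩ : ∃ H : ℚ, Q ^ M = H := ⟨_, rfl⟩
  have hQ0 : Q ≠ 0 := hQ ▸ pow_ne_zero _ hp0
  have hH0 : H ≠ 0 := hH ▸ pow_ne_zero _ hQ0
  have hD : freqDen p δ = Q ^ 6 + Q ^ 5 - Q ^ 4 + Q ^ 2 - Q - 1 := by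
    rw [freqDen, ← hQ]
    ring
  rw [hQ, pow_add, hH] at hh
  have hh0 : h ≠ 0 := by rw [hh]; positivity
  simp only [Fin.sum_univ_four, hQ, Fin.val_zero, Fin.val_one, Fin.val_two,
    show ((3 : Fin 4) : ℕ) = 3 from rfl] at h₀ h₁ h₂ h₃
  have g₁ : f 0 - Q * f 1 + Q ^ 2 * f 2 - Q ^ 3 * f 3 = ε * (h ^ 3 - h) := by
    apply mul_left_cancel₀ hh0
    linear_combination ε * h₁ - h * (f 0 - Q * f 1 + Q ^ 2 * f 2 - Q ^ 3 * f 3) * hε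
  have g₂ : f 0 + Q ^ 2 * f 1 + Q ^ 4 * f 2 + Q ^ 6 * f 3 = h ^ 2 * (h ^ 2 - 1) * (Q + 1) := by
    apply mul_left_cancel₀ (pow_ne_zero 2 hh0)
    linear_combination h₂ - h ^ 2 * (f 0 + Q ^ 2 * f 1 + Q ^ 4 * f 2 + Q ^ 6 * f 3) * hε
  have g₃ : f 0 - Q ^ 3 * f 1 + Q ^ 6 * f 2 - Q ^ 9 * f 3 =
      ε * (h * (1 + (h ^ 2 - 1) * (Q ^ 3 + 1)) - h ^ 3) := by
    apply mul_left_cancel₀ (pow_ne_zero 3 hh0)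
    linear_combination ε * h₃
      - (ε ^ 2 + 1) * h ^ 3 * (f 0 - Q ^ 3 * f 1 + Q ^ 6 * f 2 - Q ^ 9 * f 3) * hε
  rw [hD]
  subst hh
  -- Lagrange interpolation at the nodes 1, -Q, Q², -Q³: the coefficients of the gᵢ and `h₀` are
  -- those of the monic cubic vanishing at the three other nodes. At its own node the cubic takes
  -- the values -D, Q²D/(Q² - Q + 1), Q³D/(Q² - Q + 1), -Q³D respectively, whence the factors below.
  fin_cases i
  · refine Eq.trans ?_ (freqNum_zero_eq p δ M ε hQ hH).symm
    simp only [Fin.zero_eta]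
    linear_combination -(g₃ - (-Q + Q ^ 2 - Q ^ 3) * g₂ + (-Q ^ 3 + Q ^ 4 - Q ^ 5) * g₁
      - Q ^ 6 * h₀)
  · refine Eq.trans ?_ (freqNum_one_eq p δ M ε hQ hH).symm
    simp only [Fin.mk_one]
    apply mul_left_cancel₀ (pow_ne_zero 2 hQ0)
    linear_combination (Q ^ 2 - Q + 1) * (g₃ - (1 + Q ^ 2 - Q ^ 3) * g₂
      + (Q ^ 2 - Q ^ 3 - Q ^ 5) * g₁ + Q ^ 5 * h₀)
  · refine Eq.trans ?_ (freqNum_two_eq p δ M ε hQ hH).symm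
    simp only [Fin.reduceFinMk]
    apply mul_left_cancel₀ (pow_ne_zero 3 hQ0)
    linear_combination (Q ^ 2 - Q + 1) * (g₃ - (1 - Q - Q ^ 3) * g₂
      + (-Q - Q ^ 3 + Q ^ 4) * g₁ - Q ^ 4 * h₀)
  · refine Eq.trans ?_ (freqNum_three_eq p δ M ε hQ hH).symm
    simp only [Fin.reduceFinMk]
    apply mul_left_cancel₀ (pow_ne_zero 3 hQ0)
    linear_combination -(g₃ - (1 - Q + Q ^ 2) * g₂ + (-Q + Q ^ 2 - Q ^ 3) * g₁ + Q ^ 3 * h₀)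

theorem freqDen_ne_zero {p δ : ℕ} (hp : 1 < p) (hδ : 0 < δ) : freqDen p δ ≠ 0 := by
  have hQ : (1 : ℚ) < (p : ℚ) ^ δ := one_lt_pow₀ (by exact_mod_cast hp) hδ.ne'
  have h : freqDen p δ =
      ((p : ℚ) ^ δ + 1) * (((p : ℚ) ^ δ) ^ 2 - 1) * (((p : ℚ) ^ δ) ^ 3 + 1) := by
    rw [freqDen]
    ring
  have h2 : 0 < ((p : ℚ) ^ δ) ^ 2 - 1 := sub_pos.2 (one_lt_pow₀ hQ two_ne_zero)
  rw [h]
  positivity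

end Frequencies

/-! ### Multiplicities of the excess values. -/

section

variable {F K : Type*} [Field F] [DecidableEq F] [Field K] [Fintype K] [Algebra F K]
  {σ : K ≃ₐ[F] K} {Q N : ℕ}

theorem excess_zero : excess σ (0 : K × K) = Fintype.card K := by
  simp [excess, twistedForm]

variable [DecidableEq K]

/-- The number of nonzero pairs `a` whose form has excess `(-Q) ^ (N + i)`. -/
noncomputable def excessCount (σ : K ≃ₐ[F] K) (Q N : ℕ) (i : Fin 4) : ℕ :=
  #{a ∈ (univ : Finset (K × K)).erase 0 | excess σ a = (-(Q : ℤ)) ^ (N + i)}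

theorem sum_erase_eq_sum_excessCount (hQ : 1 < Q)
    (hex : ∀ a : K × K, a ≠ 0 → ∃ i : Fin 4, excess σ a = (-(Q : ℤ)) ^ (N + i))
    {M : Type*} [AddCommMonoid M] (G : K × K → M) (g : Fin 4 → M)
    (hG : ∀ a ≠ 0, ∀ i : Fin 4, excess σ a = (-(Q : ℤ)) ^ (N + i) → G a = g i) :
    ∑ a ∈ (univ : Finset (K × K)).erase 0, G a = ∑ i, excessCount σ Q N i • g i := by
  choose! t ht using hex
  -- The four values have distinct absolute values, so their classes partition the nonzero pairs.
  have hinj : ∀ i j : Fin 4, (-(Q : ℤ)) ^ (N + i) = (-(Q : ℤ)) ^ (N + j) → i = j := by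
    intro i j hij
    have h1 := congrArg Int.natAbs hij
    rw [Int.natAbs_pow, Int.natAbs_pow, Int.natAbs_neg, Int.natAbs_natCast] at h1
    have h2 := Nat.pow_right_injective hQ h1
    ext
    omega
  rw [← sum_fiberwise _ t]
  refine sum_congr rfl fun i _ => ?_
  have h1 : ({a ∈ (univ : Finset (K × K)).erase 0 | t a = i} : Finset (K × K)) =
      {a ∈ (univ : Finset (K × K)).erase 0 | excess σ a = (-(Q : ℤ)) ^ (N + i)} := by
    refine filter_congr fun a ha => ⟨?_, ?_⟩
    · rintro rfl
      exact ht a (ne_of_mem_erase ha)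
    · intro h
      exact hinj _ _ ((ht a (ne_of_mem_erase ha)).symm.trans h)
  rw [h1, excessCount, ← sum_const]
  refine sum_congr rfl fun a ha => ?_
  rw [mem_filter] at ha
  exact hG a (ne_of_mem_erase ha.1) i ha.2

theorem sum_excessCount_mul (hQ : 1 < Q)
    (hex : ∀ a : K × K, a ≠ 0 → ∃ i : Fin 4, excess σ a = (-(Q : ℤ)) ^ (N + i)) (k : ℕ) :
    ∑ i, (excessCount σ Q N i : ℤ) * ((-(Q : ℤ)) ^ (N + i)) ^ k =
      ∑ a, excess σ a ^ k - (Fintype.card K : ℤ) ^ k := by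
  rw [← add_sum_erase _ _ (mem_univ (0 : K × K)), excess_zero, add_sub_cancel_left,
    sum_erase_eq_sum_excessCount hQ hex (fun a => excess σ a ^ k)
      (fun i => ((-(Q : ℤ)) ^ (N + i)) ^ k) (fun a _ i h => by simp only [h])]
  simp

theorem NormRegular.excessCount_eq [Fintype F] {p δ M : ℕ} (hp : 1 < p) (hδ : 0 < δ)
    (h : NormRegular σ (p ^ δ)) (hF : (2 : F) ≠ 0)
    (hE : #{x : K | σ (σ x) = x} = (p ^ δ) ^ 2)
    (hK : Fintype.card K = (p ^ δ) ^ (2 * (M + 4))) (i : Fin 4) :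
    (excessCount σ (p ^ δ) (M + 4) i : ℚ) =
      freqNum p (δ * (2 * (M + 4))) δ ((-1) ^ (M + 4)) i / freqDen p δ := by
  have hQ : 1 < p ^ δ := Nat.one_lt_pow hδ.ne' hp
  have hex : ∀ a : K × K, a ≠ 0 → ∃ i : Fin 4, excess σ a = (-((p ^ δ : ℕ) : ℤ)) ^ (M + 4 + i) :=
    fun a ha => h.exists_excess_eq hF hQ hE hK ha
  have m₀ := sum_excessCount_mul hQ hex 0
  have m₁ := sum_excessCount_mul hQ hex 1
  have m₂ := sum_excessCount_mul hQ hex 2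
  have m₃ := sum_excessCount_mul hQ hex 3
  rw [h.sum_excess_sq] at m₂
  rw [h.sum_excess_cube hE] at m₃
  simp only [pow_one] at m₁
  rw [h.sum_excess] at m₁
  simp only [pow_zero, mul_one, sum_const, card_univ, Fintype.card_prod, nsmul_eq_mul] at m₀
  rw [eq_div_iff (freqDen_ne_zero hp hδ), mul_comm]
  have hs (i : Fin 4) : (-(p : ℚ) ^ δ) ^ (M + 4 + (i : ℕ)) =
      (-1) ^ (M + 4) * ((p : ℚ) ^ δ) ^ (M + 4) * (-(p : ℚ) ^ δ) ^ (i : ℕ) := by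
    rw [pow_add (-(p : ℚ) ^ δ) (M + 4), neg_pow ((p : ℚ) ^ δ) (M + 4)]
  have hq : (((p : ℚ) ^ δ) ^ (2 * (M + 4))) = (((p : ℚ) ^ δ) ^ (M + 4)) ^ 2 := by
    rw [mul_comm 2, pow_mul]
  refine eq_freqNum_of_moments (by omega) ?_ rfl (fun i => (excessCount σ (p ^ δ) (M + 4) i : ℚ))
    ?_ ?_ ?_ ?_ i
  · rw [← pow_mul, mul_comm, pow_mul, neg_one_sq, one_pow]
  · have := congrArg (Int.cast : ℤ → ℚ) m₀
    push_cast [hK, hq] at this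
    rw [this]
    ring
  · have := congrArg (Int.cast : ℤ → ℚ) m₁
    push_cast [hK, hq, hs] at this
    rw [this]
    ring
  · have := congrArg (Int.cast : ℤ → ℚ) m₂
    push_cast [hK, hq, hs] at this
    rw [this]
    ring
  · have := congrArg (Int.cast : ℤ → ℚ) m₃
    push_cast [hK, hq, hs] at this
    rw [this]
    ring

end

/-! ### Weight enumerators of parametrized codes. -/

section Enumerator

variable {ι F : Type*} [Fintype ι] [Fintype F] [DecidableEq F]

theorem comp_apply (v : ι → F) (u : F) : comp v u = #{j | v j = u} := rfl

theorem comp_mem_finsuppAntidiag (v : ι → F) :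
    comp v ∈ finsuppAntidiag (univ : Finset F) (Fintype.card ι) := by
  rw [mem_finsuppAntidiag]
  refine ⟨?_, subset_univ _⟩
  change ∑ u, #{j | v j = u} = _
  rw [← card_univ, card_eq_sum_card_fiberwise (f := v) (t := univ) (by simp)]

variable [Field F]

theorem completeWeightEnumerator_eq_sum {A : Type*} [Fintype A] (C : Submodule F (ι → F))
    (W : A → ι → F) (hW : Function.Injective W) (hC : ∀ c, c ∈ C ↔ ∃ a, W a = c) :
    completeWeightEnumerator C = ∑ a, MvPolynomial.monomial (comp (W a)) (1 : ℚ) := by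
  classical
  rw [completeWeightEnumerator, ← sum_fiberwise_of_maps_to
    (fun a _ => comp_mem_finsuppAntidiag (W a)) (fun a => MvPolynomial.monomial (comp (W a)) (1 : ℚ))]
  refine sum_congr rfl fun t _ => ?_
  have h1 : {c : ι → F | c ∈ C ∧ comp c = t} =
      (({a | comp (W a) = t} : Finset A).map ⟨W, hW⟩ : Set (ι → F)) := by
    ext c
    simp only [Set.mem_ofPred_eq, hC, coe_map, Function.Embedding.coeFn_mk, Set.mem_image, coe_filter,
      mem_univ, true_and]
    constructor
    · rintro ⟨⟨a, rfl⟩, h⟩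
      exact ⟨a, h, rfl⟩
    · rintro ⟨a, h, rfl⟩
      exact ⟨⟨a, rfl⟩, h⟩
  rw [h1, Set.ncard_coe_finset, card_map, sum_congr rfl (g := fun _ => MvPolynomial.monomial t (1 : ℚ))
    (fun a ha => by rw [(mem_filter.1 ha).2]), sum_const, ← map_nsmul, nsmul_one]

theorem monomial_comp_eq (v : ι → F) {a b : ℕ} (ha : comp v 0 = a) (hb : ∀ u ≠ 0, comp v u = b) :
    MvPolynomial.monomial (comp v) (1 : ℚ) = MvPolynomial.X 0 ^ a *
      ∏ u ∈ (univ : Finset F).erase 0, MvPolynomial.X u ^ b := by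
  rw [MvPolynomial.monomial_eq, map_one, one_mul, Finsupp.prod_fintype _ _ (by simp),
    ← mul_prod_erase _ _ (mem_univ (0 : F)), ha]
  congr 1
  exact prod_congr rfl fun u hu => by rw [hb u (ne_of_mem_erase hu)]

end Enumerator

/-! ### Words of the twisted forms. -/

section

variable {F K : Type*} [Field F] [DecidableEq F] [Field K] [Fintype K] [DecidableEq K]
  [Algebra F K] {σ : K ≃ₐ[F] K} {Q N : ℕ}

/-- The codeword of values of `twistedForm σ a` on the nonzero elements. -/
noncomputable def twistedWord (σ : K ≃ₐ[F] K) (a : K × K) : Kˣ → F :=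
  fun x => twistedForm σ a x

/-- A nonzero difference with zero word would have excess |K| = Q^(2N), but N + i < 2N because i ≤ 3
< N. -/
theorem twistedWord_injective (hQ : 1 < Q) (hN : 4 ≤ N) (hK : Fintype.card K = Q ^ (2 * N))
    (hex : ∀ a : K × K, a ≠ 0 → ∃ i : Fin 4, excess σ a = (-(Q : ℤ)) ^ (N + i)) :
    Function.Injective (twistedWord σ) := by
  intro a b hab
  by_contra hne
  obtain ⟨i, hi⟩ := hex (a - b) (sub_ne_zero.2 hne)
  have h0 : ∀ x, twistedForm σ (a - b) x = 0 := by
    intro x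
    by_cases hx : x = 0
    · rw [hx, twistedForm_zero]
    · have := congrFun hab (Units.mk0 x hx)
      simp only [twistedWord, Units.val_mk0] at this
      rw [← sub_eq_zero, twistedForm, twistedForm, ← map_sub] at this
      rw [← this, twistedForm]
      congr 1
      simp only [Prod.fst_sub, Prod.snd_sub]
      ring
  have h1 : excess σ (a - b) = Fintype.card K := by simp [excess, h0]
  rw [h1, hK] at hi
  have h2 := congrArg Int.natAbs hi
  rw [Int.natAbs_pow, Int.natAbs_neg, Int.natAbs_natCast, Int.natAbs_natCast] at h2
  have h3 := Nat.pow_right_injective hQ h2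
  omega

variable [Fintype F]

theorem NormRegular.comp_twistedWord (h : NormRegular σ Q) (a : K × K) {u : F} (hu : u ≠ 0) :
    comp (twistedWord σ a) u = #{x : K | twistedForm σ a x = 1} := by
  rw [← h.card_twistedForm_eq a hu, card_filter_units _ (by simpa [twistedForm_zero] using hu.symm),
    comp_apply]
  rfl

/-- The extra 1 is the point x = 0, a zero of the form but not a coordinate of the word. -/
theorem comp_twistedWord_zero (a : K × K) :
    comp (twistedWord σ a) 0 + 1 = #{x : K | twistedForm σ a x = 0} := by
  rw [← card_erase_add_one (a := 0) (s := {x : K | twistedForm σ a x = 0})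
    (by simp [twistedForm_zero]), comp_apply]
  have h1 := card_filter_units (fun x : K => x ≠ 0 ∧ twistedForm σ a x = 0) (by simp)
  congr 1
  convert h1.symm using 2
  · ext x
    simp only [mem_filter, mem_univ, true_and, ne_eq, Units.ne_zero, not_false_eq_true]
    rfl
  · ext x
    simp

/-- The complete weight enumerator of a code consisting of the words `twistedWord σ a`. -/
theorem NormRegular.completeWeightEnumerator_eq (h : NormRegular σ Q) (hF : (2 : F) ≠ 0)
    (hQ : 1 < Q) (hN : 4 ≤ N) (hE : #{x : K | σ (σ x) = x} = Q ^ 2)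
    (hK : Fintype.card K = Q ^ (2 * N)) (C : Submodule F (Kˣ → F))
    (hC : ∀ c, c ∈ C ↔ ∃ a, twistedWord σ a = c) (α β : Fin 4 → ℕ)
    (hβ : ∀ i : Fin 4, (β i : ℤ) * Fintype.card F = Q ^ (2 * N) - (-(Q : ℤ)) ^ (N + i))
    (hα : ∀ i : Fin 4, (α i : ℤ) + 1 = β i + (-(Q : ℤ)) ^ (N + i)) :
    completeWeightEnumerator C = MvPolynomial.X 0 ^ (Fintype.card K - 1) +
      ∑ i : Fin 4, MvPolynomial.C (excessCount σ Q N i : ℚ) * (MvPolynomial.X 0 ^ α i *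
        ∏ u ∈ (univ : Finset F).erase 0, MvPolynomial.X u ^ β i) := by
  have hex : ∀ a : K × K, a ≠ 0 → ∃ i : Fin 4, excess σ a = (-(Q : ℤ)) ^ (N + i) :=
    fun a ha => h.exists_excess_eq hF hQ hE hK ha
  rw [completeWeightEnumerator_eq_sum C _ (twistedWord_injective hQ hN hK hex) hC,
    ← add_sum_erase _ _ (mem_univ (0 : K × K))]
  congr 1
  · have h0 : twistedWord σ (0 : K × K) = 0 := by
      ext x
      simp [twistedWord, twistedForm]
    rw [monomial_comp_eq _ (a := Fintype.card K - 1) (b := 0)]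
    · simp
    · rw [h0, comp_apply, ← Fintype.card_units]
      simp
    · intro u hu
      rw [h0, comp_apply]
      rw [card_eq_zero, filter_eq_empty_iff]
      exact fun x _ => hu.symm
  · rw [sum_erase_eq_sum_excessCount hQ hex _ (fun i => MvPolynomial.X 0 ^ α i *
      ∏ u ∈ (univ : Finset F).erase 0, MvPolynomial.X u ^ β i)]
    · refine sum_congr rfl fun i _ => ?_
      rw [nsmul_eq_mul, map_natCast]
    · intro a _ i hi
      have h1 : #{x : K | twistedForm σ a x = 1} = β i := by
        have h2 := h.card_eq a
        rw [hi, hK] at h2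
        have h3 := hβ i
        push_cast at h2
        have hc : (Fintype.card F : ℤ) ≠ 0 := by exact_mod_cast Fintype.card_ne_zero
        have h4 : ((#{x : K | twistedForm σ a x = 1} : ℕ) : ℤ) = β i := by
          apply mul_right_cancel₀ hc
          linarith
        exact_mod_cast h4
      apply monomial_comp_eq
      · have h2 := comp_twistedWord_zero (σ := σ) a
        have h3 := hα i
        rw [← h1, ← hi, excess, ← h2] at h3
        push_cast at h3
        have h4 : ((comp (twistedWord σ a) 0 : ℕ) : ℤ) = α i := by linarith
        exact_mod_cast h4
      · intro u hu
        rw [h.comp_twistedWord a hu, h1]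

end

/-! ### The exponents `expA` and `expB`. -/

section Exponents

variable {p m ℓ N : ℕ}

theorem neg_pow_eq_eps (hm : m = m.gcd ℓ * (2 * N)) (hδ : 0 < m.gcd ℓ) (i : ℕ) :
    (-((p ^ m.gcd ℓ : ℕ) : ℤ)) ^ (N + i) =
      (-1) ^ i * eps m ℓ * (p : ℤ) ^ (m / 2 + i * m.gcd ℓ) := by
  have h1 : mSub m ℓ / 2 = N := by
    rw [mSub, Nat.div_eq_of_eq_mul_right hδ hm, Nat.mul_div_cancel_left _ two_pos]
  have h2 : m / 2 = m.gcd ℓ * N := by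
    conv_lhs => rw [hm, mul_left_comm, Nat.mul_div_cancel_left _ two_pos]
  rw [eps, h1, h2, neg_pow, pow_add (-1 : ℤ) N i]
  push_cast
  rw [← pow_mul, mul_comm i, ← mul_add]
  ring

theorem expB_mul (hm : m = m.gcd ℓ * (2 * N)) (hN : 0 < N) (hδ : 0 < m.gcd ℓ)
    (i : Fin 4) : expB p m ℓ i * p =
      ((p ^ m.gcd ℓ : ℕ) : ℤ) ^ (2 * N) - (-((p ^ m.gcd ℓ : ℕ) : ℤ)) ^ (N + i) := by
  have h2 : m / 2 = m.gcd ℓ * N := by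
    conv_lhs => rw [hm, mul_left_comm, Nat.mul_div_cancel_left _ two_pos]
  have h3 : 0 < m / 2 := h2 ▸ Nat.mul_pos hδ hN
  have h4 : ((p ^ m.gcd ℓ : ℕ) : ℤ) ^ (2 * N) = (p : ℤ) ^ m := by
    push_cast
    rw [← pow_mul, ← hm]
  obtain ⟨k, hk⟩ : ∃ k, m = k + 1 := ⟨m - 1, by omega⟩
  obtain ⟨j, hj⟩ : ∃ j, m / 2 + i * m.gcd ℓ = j + 1 := ⟨m / 2 + i * m.gcd ℓ - 1, by omega⟩
  rw [neg_pow_eq_eps hm hδ, h4, expB, hj, show m - 1 = k by omega]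
  rw [show (p : ℤ) ^ m = (p : ℤ) ^ k * p by rw [← pow_succ, ← hk], Nat.add_sub_cancel]
  ring

theorem expA_add_one (hm : m = m.gcd ℓ * (2 * N)) (hN : 0 < N) (hδ : 0 < m.gcd ℓ)
    (i : Fin 4) : expA p m ℓ i + 1 =
      expB p m ℓ i + (-((p ^ m.gcd ℓ : ℕ) : ℤ)) ^ (N + i) := by
  have h2 : m / 2 = m.gcd ℓ * N := by
    conv_lhs => rw [hm, mul_left_comm, Nat.mul_div_cancel_left _ two_pos]
  have h3 : 0 < m / 2 := h2 ▸ Nat.mul_pos hδ hN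
  obtain ⟨j, hj⟩ : ∃ j, m / 2 + i * m.gcd ℓ = j + 1 := ⟨m / 2 + i * m.gcd ℓ - 1, by omega⟩
  rw [neg_pow_eq_eps hm hδ, expA, expB, hj, Nat.add_sub_cancel]
  ring

/-- From N ≥ 4 and i ≤ 3, m/2 + iδ ≤ m - 1. With j = m/2 + iδ - 1 this gives p · p^j ≤ p^(m-1),
which absorbs (p - 1) p^j and the final -1. -/
theorem exponents_nonneg (hp : 1 < p) (hm : m = m.gcd ℓ * (2 * N)) (hN : 4 ≤ N)
    (hδ : 0 < m.gcd ℓ) (i : Fin 4) : 0 ≤ expA p m ℓ i ∧ 0 ≤ expB p m ℓ i := by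
  have h2 : m / 2 = m.gcd ℓ * N := by
    conv_lhs => rw [hm, mul_left_comm, Nat.mul_div_cancel_left _ two_pos]
  have h3 : 0 < m / 2 := h2 ▸ Nat.mul_pos hδ (by omega)
  have h4 : m / 2 + i * m.gcd ℓ + 1 ≤ m := by
    rw [h2]
    conv_rhs => rw [hm]
    have : (i : ℕ) ≤ 3 := by omega
    nlinarith
  obtain ⟨j, hj⟩ : ∃ j, m / 2 + i * m.gcd ℓ = j + 1 := ⟨m / 2 + i * m.gcd ℓ - 1, by omega⟩
  have hp' : (1 : ℤ) < p := by exact_mod_cast hp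
  have h5 : (p : ℤ) * (p : ℤ) ^ j ≤ (p : ℤ) ^ (m - 1) := by
    rw [← pow_succ']
    exact pow_le_pow_right₀ hp'.le (by omega)
  have h6 : 1 ≤ (p : ℤ) ^ j := one_le_pow₀ hp'.le
  have h7 : (p : ℤ) ^ j ≤ p * (p : ℤ) ^ j := by nlinarith
  have h8 : 0 ≤ (p - 1 : ℤ) * (p : ℤ) ^ j := by nlinarith
  rw [expA, expB, hj, Nat.add_sub_cancel, pow_succ (-1 : ℤ) (i : ℕ)]
  have hs : (-1) ^ (i : ℕ) * eps m ℓ = 1 ∨ (-1) ^ (i : ℕ) * eps m ℓ = -1 := by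
    rw [eps, ← pow_add]
    exact neg_one_pow_eq_or ℤ _
  rw [show (-1 : ℤ) ^ (i : ℕ) * -1 * eps m ℓ = -((-1) ^ (i : ℕ) * eps m ℓ) by ring]
  rcases hs with hs | hs <;> rw [hs] <;> constructor <;> linarith

end Exponents

/-! ### Identification of the code and conclusion. -/

section Code

variable {p ℓ : ℕ} [Fact p.Prime] {K : Type*} [Field K] [Fintype K] [Algebra (ZMod p) K]

/-- The automorphism `x ↦ x ^ p ^ ℓ` of a finite field of characteristic `p`. -/
noncomputable def frobPow (p ℓ : ℕ) [Fact p.Prime] (K : Type*) [Field K] [Fintype K]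
    [Algebra (ZMod p) K] : K ≃ₐ[ZMod p] K :=
  FiniteField.frobeniusAlgEquivOfAlgebraic (ZMod p) K ^ ℓ

theorem frobPow_apply (x : K) : frobPow p ℓ K x = x ^ p ^ ℓ := by
  rw [frobPow, AlgEquiv.coe_pow, FiniteField.coe_frobeniusAlgEquivOfAlgebraic_iterate, ZMod.card]

theorem mem_code_familyL_iff (c : Kˣ → ZMod p) :
    c ∈ code (ZMod p) (familyL K p ℓ) ↔ ∃ a, twistedWord (frobPow p ℓ K) a = c := by
  have key (a b : K) : word (ZMod p) K (a • (X : K[X]) ^ p ^ ℓ + b • (X : K[X]) ^ p ^ (3 * ℓ)) =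
      twistedWord (frobPow p ℓ K) (a, b) := by
    funext x
    simp only [word, LinearMap.coe_mk, AddHom.coe_mk, twistedWord, twistedForm, frobPow_apply,
      eval_add, eval_smul, eval_pow, eval_X, smul_eq_mul]
    congr 1
    rw [← pow_mul, ← pow_mul, ← pow_add, ← pow_add, show ℓ + (ℓ + ℓ) = 3 * ℓ by ring]
    ring
  rw [code, familyL]
  simp only [Submodule.mem_map, Submodule.restrictScalars_mem, Submodule.mem_span_pair]
  constructor
  · rintro ⟨_, ⟨a, b, rfl⟩, rfl⟩
    exact ⟨(a, b), (key a b).symm⟩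
  · rintro ⟨⟨a, b⟩, rfl⟩
    exact ⟨_, ⟨a, b, rfl⟩, key a b⟩

end Code

end TraceCode

theorem corollary5p4 {p m ℓ : ℕ} [Fact p.Prime] (hp : p ≠ 2) (hm : 0 < m) (hℓ : 0 < ℓ)
    (heven : Even (TraceCode.mSub m ℓ)) (hlt : 6 * ℓ < m)
    {K : Type*} [Field K] [Fintype K] [DecidableEq K] [Algebra (ZMod p) K]
    (hK : Fintype.card K = p ^ m) :
    ∃ a b : Fin 4 → ℕ,
      (∀ i, (a i : ℤ) = TraceCode.expA p m ℓ i) ∧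
      (∀ i, (b i : ℤ) = TraceCode.expB p m ℓ i) ∧
      TraceCode.completeWeightEnumerator
          (TraceCode.code (ZMod p) (TraceCode.familyL K p ℓ)) =
        MvPolynomial.X 0 ^ (p ^ m - 1) +
          ∑ i : Fin 4, MvPolynomial.C (TraceCode.freq p m ℓ i) *
            (MvPolynomial.X 0 ^ a i *
              ∏ u ∈ (Finset.univ : Finset (ZMod p)).erase 0, MvPolynomial.X u ^ b i) := by
  open TraceCode in
  have hpp : p.Prime := Fact.out
  have hδ : 0 < m.gcd ℓ := Nat.gcd_pos_of_pos_left _ hm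
  obtain ⟨N, hN⟩ := heven
  obtain ⟨k, hk⟩ := Nat.gcd_dvd_right m ℓ
  have hmN : m = m.gcd ℓ * (2 * N) := by
    rw [two_mul, ← hN, mSub, Nat.mul_div_cancel' (Nat.gcd_dvd_left m ℓ)]
  have hcop : k.Coprime (2 * N) := by
    have h1 : m.gcd ℓ * Nat.gcd (2 * N) k = m.gcd ℓ := by
      rw [← Nat.gcd_mul_left, ← hmN, ← hk]
    exact (Nat.gcd_comm _ _).trans (Nat.eq_of_mul_eq_mul_left hδ (h1.trans (mul_one _).symm))
  have hkodd : Odd k := Nat.coprime_two_right.1 (hcop.coprime_mul_right_right)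
  have hkN : k.Coprime N := hcop.coprime_mul_left_right
  -- δ ≤ ℓ gives 6δ < m = 2Nδ, so N > 3.
  have hN4 : 4 ≤ N := by
    have h1 : m.gcd ℓ * 6 < m.gcd ℓ * (2 * N) := by
      rw [← hmN]
      have := Nat.gcd_le_right m hℓ
      omega
    have := Nat.lt_of_mul_lt_mul_left h1
    omega
  have hQ : 1 < p ^ m.gcd ℓ := Nat.one_lt_pow hδ.ne' hpp.one_lt
  have hF : (2 : ZMod p) ≠ 0 := by
    intro h
    have h1 : ((2 : ℕ) : ZMod p) = 0 := by exact_mod_cast h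
    rw [ZMod.natCast_eq_zero_iff, Nat.prime_dvd_prime_iff_eq hpp Nat.prime_two] at h1
    exact hp h1
  have hreg : NormRegular (frobPow p ℓ K) (p ^ m.gcd ℓ) := by
    intro c hc hc0
    rw [frobPow_apply] at hc
    simp only [frobPow_apply]
    exact card_norm_eq hK hmN hk hkodd hkN hc0 hc
  have hE : (Finset.univ.filter fun x : K => frobPow p ℓ K (frobPow p ℓ K x) = x).card
      = (p ^ m.gcd ℓ) ^ 2 := by
    simp only [frobPow_apply, ← pow_mul, ← pow_add]
    rw [card_pow_eq_self hK]
    have h1 : m.gcd (ℓ + ℓ) = (m.gcd ℓ * (2 * N)).gcd (m.gcd ℓ * (2 * k)) := by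
      congr 1
      rw [mul_left_comm, ← hk, two_mul]
    rw [h1, Nat.gcd_mul_left, Nat.gcd_mul_left, Nat.gcd_comm N k, hkN, mul_one]
  have hKQ : Fintype.card K = (p ^ m.gcd ℓ) ^ (2 * N) := by
    rw [hK, ← pow_mul, ← hmN]
  have hA (i : Fin 4) := (exponents_nonneg hpp.one_lt hmN hN4 hδ i).1
  have hB (i : Fin 4) := (exponents_nonneg hpp.one_lt hmN hN4 hδ i).2
  refine ⟨fun i => (expA p m ℓ i).toNat, fun i => (expB p m ℓ i).toNat,
    fun i => Int.toNat_of_nonneg (hA i), fun i => Int.toNat_of_nonneg (hB i), ?_⟩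
  rw [hreg.completeWeightEnumerator_eq hF hQ hN4 hE hKQ _ mem_code_familyL_iff
    (fun i => (expA p m ℓ i).toNat) (fun i => (expB p m ℓ i).toNat), hK]
  · congr 1
    refine Finset.sum_congr rfl fun i _ => ?_
    congr 2
    obtain ⟨M, rfl⟩ : ∃ M, N = M + 4 := ⟨N - 4, by omega⟩
    rw [hreg.excessCount_eq hpp.one_lt hδ hF hE hKQ i, freq, eps, hN, ← two_mul,
      Nat.mul_div_cancel_left _ two_pos, ← hmN]
    push_cast
    rfl
  · intro i
    rw [Int.toNat_of_nonneg (hB i), ZMod.card]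
    exact expB_mul hmN (by omega) hδ i
  · intro i
    rw [Int.toNat_of_nonneg (hA i), Int.toNat_of_nonneg (hB i)]
    exact expA_add_one hmN (by omega) hδ i
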